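/- Let $q,p\in\mathbb C^\times$ with $|q|<1$, $|p|<1$, let $c\in\mathbb Z$, $p^*=pq^{-2c}$ with $|p^*|<1$, and $\Lambda=q^{2\mathbb Z}p^{\mathbb Z}$. Put $(z;p_1,\dots,p_m)_\infty=\prod_{n_i\ge 0}(1-zp_1^{n_1}\cdots p_m^{n_m})$ and $\Theta_p(z)=(z;p)_\infty(pz^{-1};p)_\infty(p;p)_\infty$. The dynamical parameter $\lambda$ is given by $s\in\mathbb C$, $w=q^{2s}$ (principal branch), and a shift of $\lambda$ by an eigenvalue $\pm1$ of $\sigma_z=\mathrm{diag}(1,-1)$ is $s\mapsto s\pm1$. On $V\otimes V$, $V=\mathbb C^2$, let $$R(z,\lambda)=\rho(z)\begin{pmatrix}1&0&0&0\\0&b&\gamma&0\\0&\bar\gamma&\bar b&0\\0&0&0&1\end{pmatrix},\quad b=\frac{\Theta_p(q^2w)\Theta_p(z)}{\Theta_p(w)\Theta_p(q^2z)},\quad \gamma=\frac{\Theta_p(q^2)\Theta_p(wz)}{\Theta_p(w)\Theta_p(q^2z)},$$ where $\bar b,\bar\gamma$ are obtained from $b,\gamma$ by $w\mapsto w^{-1}$,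 and $$\rho(z)=q^{-1/2}\,\frac{(q^2z;p,q^4)_\infty^2\,(pz^{-1};p,q^4)_\infty\,(pq^4z^{-1};p,q^4)_\infty}{(pq^2z^{-1};p,q^4)_\infty^2\,(z;p,q^4)_\infty\,(q^4z;p,q^4)_\infty}.$$ Let $R^*$ be $R$ with $p$ replaced by $p^*$. Fix $\kappa\in\mathbb C$ and call $\lambda$ admissible if $q^{2s}\notin\Lambda$ and $q^{2(s+\kappa)}\notin\Lambda$. The dynamical elliptic quantum algebra $\mathcal B=\mathcal B_{q,\lambda}(\widehat{gl}_2)$ at central charge $c$ is the unital $\mathbb C$-algebra generated by the entries of the $2\times2$ matrices $L^\pm(z,\lambda)$ and of their two-sided inverses $L^\pm(z,\lambda)^{-1}$ ($z\in\mathbb C^\times$, $\lambda$ admissible) and by the algebra of functions $f(h)$ on the set $\kappa+\mathbb Z$ of eigenvalues of the Cartan generator $h$, subject to the zero-weight condition $[\sigma_z+h,L^\pm(z,\lambda)]=0$, that is, $f(h)L^\pm_{ij}(z,\lambda)=L^\pm_{ij}(z,\lambda)f(h+\sigma_j-\sigma_i)$ with $\sigma_1=1$, $\sigma_2=-1$,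 and to $$R^*_{12}(z_1/z_2,\lambda+h)\,L^\pm_1(z_1,\lambda)\,L^\pm_2(z_2,\lambda+\sigma_z^{(1)})=L^\pm_2(z_2,\lambda)\,L^\pm_1(z_1,\lambda+\sigma_z^{(2)})\,R_{12}(z_1/z_2,\lambda),$$ $$R^*_{12}(q^cz_1/z_2,\lambda+h)\,L^+_1(z_1,\lambda)\,L^-_2(z_2,\lambda+\sigma_z^{(1)})=L^-_2(z_2,\lambda)\,L^+_1(z_1,\lambda+\sigma_z^{(2)})\,R_{12}(q^{-c}z_1/z_2,\lambda)$$ for admissible $\lambda$ and all $z_1,z_2\in\mathbb C^\times$ for which the spectral arguments of $R^*$ and $R$ in the relation lie outside $\Lambda$, a set containing all their zeros and poles. With $\partial=\partial/\partial\lambda$ (so that $e^{\pm\sigma_z\partial}$ shifts $\lambda$ by $\pm\sigma_z$), $\Upsilon(\lambda)=q^{-s}\Theta_p(q^{2s})$ and $N(\lambda)=\Upsilon(\lambda-\sigma_z)/\Upsilon(\lambda)$, define in $\mathcal B$ $$t(z,\lambda)=\mathrm{tr}\big(N(\lambda)e^{-\sigma_z\partial}L^+(q^{-c}z,\lambda)^{-1}L^-(z,\lambda)e^{\sigma_z\partial}\big),\qquad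 t^*(z,\lambda)=\mathrm{tr}\big(N(\lambda)e^{-\sigma_z\partial}L^-(q^{c}z,\lambda)^{-1}L^+(z,\lambda)e^{\sigma_z\partial}\big);$$ the shift operators cancel, e.g. $t(z,\lambda)=\sum_i N_{ii}(\lambda)\big(L^+(q^{-c}z,\lambda-\sigma_i)^{-1}L^-(z,\lambda-\sigma_i)\big)_{ii}$. Let $\lambda$ be admissible. If $c=-2$, then $[t(z_1,\lambda),t(z_2,\lambda)]=0$ for all $z_1,z_2\in\mathbb C^\times$ with $z_1/z_2\notin\Lambda$; consequently, for every set $Z\subset\mathbb C^\times$ of spectral parameters with pairwise ratios of distinct elements outside $\Lambda$, the subalgebra of $\mathcal B$ generated by the $t(z,\lambda)$, $z\in Z$, is commutative. If $c=2$ (and $|p^*|=|pq^{-4}|<1$), the same two statements hold for $t^*(z,\lambda)$. -/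

import Mathlib

noncomputable section

namespace DynamicalElliptic

/-! ### Theta functions and the dynamical R-matrix -/

/-- `(z;p)_∞ = ∏_{n ≥ 0} (1 - z pⁿ)`. -/
def poch (p z : ℂ) : ℂ := ∏' n : ℕ, (1 - z * p ^ n)

/-- `(z;p₁,p₂)_∞ = ∏_{m,n ≥ 0} (1 - z p₁ᵐ p₂ⁿ)`. -/
def poch₂ (p₁ p₂ z : ℂ) : ℂ := ∏' n : ℕ × ℕ, (1 - z * p₁ ^ n.1 * p₂ ^ n.2)

/-- The Jacobi theta function `Θ_p(z) = (z;p)_∞ (p/z;p)_∞ (p;p)_∞`. -/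
def theta (p z : ℂ) : ℂ := poch p z * poch p (p * z⁻¹) * poch p p

/-- The normalization factor `ρ(z)` of the R-matrix with nome `p`. -/
def rho (q p z : ℂ) : ℂ :=
  q ^ (-(1 / 2) : ℂ) *
    ((poch₂ p (q ^ 4) (q ^ 2 * z) ^ 2 * poch₂ p (q ^ 4) (p * z⁻¹)
        * poch₂ p (q ^ 4) (p * q ^ 4 * z⁻¹)) /
      (poch₂ p (q ^ 4) (p * q ^ 2 * z⁻¹) ^ 2 * poch₂ p (q ^ 4) z
        * poch₂ p (q ^ 4) (q ^ 4 * z)))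

/-- `w = q^{2s}`, where `s` is the coordinate of the dynamical parameter `λ`. -/
def dynW (q s : ℂ) : ℂ := q ^ (2 * s)

/-- Diagonal entry `b(z)`; the other one, `b̄(z)`, is obtained by `w ↦ w⁻¹`. -/
def bFun (q p w z : ℂ) : ℂ := theta p (q ^ 2 * w) * theta p z / (theta p w * theta p (q ^ 2 * z))

/-- Off-diagonal entry `c(z)`; the other one, `c̄(z)`, is obtained by `w ↦ w⁻¹`. -/
def cFun (q p w z : ℂ) : ℂ := theta p (q ^ 2) * theta p (w * z) / (theta p w * theta p (q ^ 2 * z))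

/-- The dynamical R-matrix `R(z, λ)` with nome `p`, on `ℂ² ⊗ ℂ²` with basis ordered as
`(0,0), (0,1), (1,0), (1,1)`. -/
def RMat (q p z s : ℂ) : Matrix (Fin 2 × Fin 2) (Fin 2 × Fin 2) ℂ :=
  let w := dynW q s
  rho q p z •
    (!![1, 0, 0, 0;
        0, bFun q p w z, cFun q p w z, 0;
        0, cFun q p w⁻¹ z, bFun q p w⁻¹ z, 0;
        0, 0, 0, 1] : Matrix (Fin (2 * 2)) (Fin (2 * 2)) ℂ).submatrix
      finProdFinEquiv finProdFinEquiv

/-- The eigenvalues `1, -1` of `σ_z` on `V = ℂ²`.  The shift `λ ↦ λ + σ_z` is `s ↦ s ± 1`. -/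
def sgn : Fin 2 → ℤ := ![1, -1]

/-- `Υ(λ) = w^{-1/2} Θ_p(w)`, with `w^{-1/2} = q^{-s}`. -/
def upsilon (q p s : ℂ) : ℂ := q ^ (-s) * theta p (dynW q s)

/-- The diagonal entries of `N(λ) = Υ(λ - σ_z) / Υ(λ)`. -/
def NDiag (q p s : ℂ) (i : Fin 2) : ℂ := upsilon q p (s - (sgn i : ℂ)) / upsilon q p s

/-- The shifted nome `p* = p q^{-2c}`. -/
def starNome (q p : ℂ) (c : ℤ) : ℂ := p * q ^ (-2 * c)

/-- The multiplicative lattice `q^{2ℤ} p^{ℤ}`, which contains all zeros and poles of the structure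
functions, in the spectral as well as in the dynamical variable. -/
def lattice (q p : ℂ) : Set ℂ := {x | ∃ a b : ℤ, x = q ^ (2 * a) * p ^ b}

/-- Values `s` of the dynamical parameter for which `R(z, λ)` and `R*(z, λ + h)`, as well as all
their shifts, have no singularity in `λ`; here `h` has its eigenvalues in `κ + ℤ`. -/
def Admissible (q p κ s : ℂ) : Prop := dynW q s ∉ lattice q p ∧ dynW q (s + κ) ∉ lattice q p

/-! ### Matrices with entries in an algebra -/

section Tensor

variable {A : Type*} [Ring A]

/-- `M₁ = M ⊗ 1`. -/
def leg₁ (M : Matrix (Fin 2) (Fin 2) A) : Matrix (Fin 2 × Fin 2) (Fin 2 × Fin 2) A :=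
  Matrix.of fun a b => if a.2 = b.2 then M a.1 b.1 else 0

/-- `M₂ = 1 ⊗ M`. -/
def leg₂ (M : Matrix (Fin 2) (Fin 2) A) : Matrix (Fin 2 × Fin 2) (Fin 2 × Fin 2) A :=
  Matrix.of fun a b => if a.1 = b.1 then M a.2 b.2 else 0

/-- `M₁(λ + h⁽²⁾)`: the argument is shifted by the weight of the second leg. -/
def leg₁Shift (M : ℂ → Matrix (Fin 2) (Fin 2) A) (s : ℂ) :
    Matrix (Fin 2 × Fin 2) (Fin 2 × Fin 2) A :=
  Matrix.of fun a b => if a.2 = b.2 then M (s + (sgn a.2 : ℂ)) a.1 b.1 else 0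

/-- `M₂(λ + h⁽¹⁾)`: the argument is shifted by the weight of the first leg. -/
def leg₂Shift (M : ℂ → Matrix (Fin 2) (Fin 2) A) (s : ℂ) :
    Matrix (Fin 2 × Fin 2) (Fin 2 × Fin 2) A :=
  Matrix.of fun a b => if a.1 = b.1 then M (s + (sgn a.1 : ℂ)) a.2 b.2 else 0

end Tensor

/-! ### The algebra by generators and relations -/

/-- The labels of the two Lax matrices `L⁺` and `L⁻`. -/
inductive LaxSign : Type
  | plus
  | minus

/-- Generators: the entries of `L^±(z, λ)`, the entries of `L^±(z, λ)⁻¹`, and the functions `f(h)`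
of the Cartan generator `h`, whose eigenvalues lie in `κ + ℤ`; such a function is recorded as
`m ↦ f(κ + m)`. -/
inductive Gen : Type
  | lax (e : LaxSign) (z s : ℂ) (i j : Fin 2)
  | laxInv (e : LaxSign) (z s : ℂ) (i j : Fin 2)
  | cartan (f : ℤ → ℂ)

/-- The free algebra on the generators. -/
abbrev FreeB : Type := FreeAlgebra ℂ Gen

/-- `L^±(z, λ)` in the free algebra. -/
def freeLax (e : LaxSign) (z s : ℂ) : Matrix (Fin 2) (Fin 2) FreeB :=
  Matrix.of fun i j => FreeAlgebra.ι ℂ (Gen.lax e z s i j)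

/-- The generators that are to invert `L^±(z, λ)`. -/
def freeLaxInv (e : LaxSign) (z s : ℂ) : Matrix (Fin 2) (Fin 2) FreeB :=
  Matrix.of fun i j => FreeAlgebra.ι ℂ (Gen.laxInv e z s i j)

/-- `f(h)` in the free algebra. -/
def freeCartan (f : ℤ → ℂ) : FreeB := FreeAlgebra.ι ℂ (Gen.cartan f)

/-- `R(z, λ)` as a matrix of scalars of the free algebra. -/
def freeR (q p z s : ℂ) : Matrix (Fin 2 × Fin 2) (Fin 2 × Fin 2) FreeB :=
  (RMat q p z s).map (algebraMap ℂ FreeB)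

/-- `R(z, λ + h)`, with nome `p`, as a matrix of functions of `h`. -/
def freeRCartan (q p κ z s : ℂ) : Matrix (Fin 2 × Fin 2) (Fin 2 × Fin 2) FreeB :=
  Matrix.of fun a b => freeCartan fun m => RMat q p z (s + κ + (m : ℂ)) a b

/-- The defining relations at central charge `c`. -/
inductive Rel (q p κ : ℂ) (c : ℤ) : FreeB → FreeB → Prop
  | cartan_const (a : ℂ) : Rel q p κ c (freeCartan fun _ => a) (algebraMap ℂ FreeB a)
  | cartan_add (f g : ℤ → ℂ) :
      Rel q p κ c (freeCartan (f + g)) (freeCartan f + freeCartan g)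
  | cartan_mul (f g : ℤ → ℂ) :
      Rel q p κ c (freeCartan (f * g)) (freeCartan f * freeCartan g)
  /-- The zero-weight condition `[σ_z + h, L^±(z, λ)] = 0`, for functions of `h`. -/
  | weight (e : LaxSign) (z s : ℂ) (hz : z ≠ 0) (hs : Admissible q p κ s) (i j : Fin 2)
      (f : ℤ → ℂ) :
      Rel q p κ c (freeCartan f * freeLax e z s i j)
        (freeLax e z s i j * freeCartan fun m => f (m + sgn j - sgn i))
  | mul_inv (e : LaxSign) (z s : ℂ) (hz : z ≠ 0) (hs : Admissible q p κ s) (i j : Fin 2) :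
      Rel q p κ c ((freeLax e z s * freeLaxInv e z s) i j)
        ((1 : Matrix (Fin 2) (Fin 2) FreeB) i j)
  | inv_mul (e : LaxSign) (z s : ℂ) (hz : z ≠ 0) (hs : Admissible q p κ s) (i j : Fin 2) :
      Rel q p κ c ((freeLaxInv e z s * freeLax e z s) i j)
        ((1 : Matrix (Fin 2) (Fin 2) FreeB) i j)
  /-- `R*₁₂(z₁/z₂, λ+h) L^±₁(z₁,λ) L^±₂(z₂,λ+h⁽¹⁾) = L^±₂(z₂,λ) L^±₁(z₁,λ+h⁽²⁾) R₁₂(z₁/z₂,λ)`. -/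
  | rll (e : LaxSign) (z₁ z₂ s : ℂ) (hz₁ : z₁ ≠ 0) (hz₂ : z₂ ≠ 0) (hs : Admissible q p κ s)
      (hz : z₁ / z₂ ∉ lattice q p) (a b : Fin 2 × Fin 2) :
      Rel q p κ c
        ((freeRCartan q (starNome q p c) κ (z₁ / z₂) s
          * leg₁ (freeLax e z₁ s) * leg₂Shift (freeLax e z₂) s) a b)
        ((leg₂ (freeLax e z₂ s) * leg₁Shift (freeLax e z₁) s * freeR q p (z₁ / z₂) s) a b)
  /-- `R*₁₂(q^c z₁/z₂, λ+h) L⁺₁(z₁,λ) L⁻₂(z₂,λ+h⁽¹⁾) =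
  L⁻₂(z₂,λ) L⁺₁(z₁,λ+h⁽²⁾) R₁₂(q^{-c} z₁/z₂,λ)`. -/
  | rll_mixed (z₁ z₂ s : ℂ) (hz₁ : z₁ ≠ 0) (hz₂ : z₂ ≠ 0) (hs : Admissible q p κ s)
      (hz : q ^ c * z₁ / z₂ ∉ lattice q p) (hz' : q ^ (-c) * z₁ / z₂ ∉ lattice q p)
      (a b : Fin 2 × Fin 2) :
      Rel q p κ c
        ((freeRCartan q (starNome q p c) κ (q ^ c * z₁ / z₂) s
          * leg₁ (freeLax .plus z₁ s) * leg₂Shift (freeLax .minus z₂) s) a b)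
        ((leg₂ (freeLax .minus z₂ s) * leg₁Shift (freeLax .plus z₁) s
          * freeR q p (q ^ (-c) * z₁ / z₂) s) a b)

/-- The dynamical elliptic quantum algebra of `ĝl₂` at central charge `c`, in its presentation by
Lax matrices. -/
abbrev BAlg (q p κ : ℂ) (c : ℤ) : Type := RingQuot (Rel q p κ c)

/-- The Lax matrices `L^±(z, λ)`. -/
def lax (q p κ : ℂ) (c : ℤ) (e : LaxSign) (z s : ℂ) : Matrix (Fin 2) (Fin 2) (BAlg q p κ c) :=
  (freeLax e z s).map (RingQuot.mkAlgHom ℂ (Rel q p κ c))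

/-- The inverse Lax matrices `L^±(z, λ)⁻¹`. -/
def laxInv (q p κ : ℂ) (c : ℤ) (e : LaxSign) (z s : ℂ) :
    Matrix (Fin 2) (Fin 2) (BAlg q p κ c) :=
  (freeLaxInv e z s).map (RingQuot.mkAlgHom ℂ (Rel q p κ c))

/-! ### The dynamical traces -/

section Trace

variable {A : Type*} [Ring A] [Algebra ℂ A]

/-- The coefficient function of `tr (N(λ) e^{-σ_z ∂} M(λ) e^{σ_z ∂})`, that is
`∑ᵢ Nᵢ(λ) Mᵢᵢ(λ - σᵢ)`; see `trace_eq_mulLeft_dynTrace`. -/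
def dynTrace (q p : ℂ) (M : ℂ → Matrix (Fin 2) (Fin 2) A) (s : ℂ) : A :=
  ∑ i, NDiag q p s i • M (s - (sgn i : ℂ)) i i

/-- The operator `e^{a ∂}` on functions of the dynamical parameter. -/
def shiftOp (a : ℂ) : Module.End ℂ (ℂ → A) := LinearMap.funLeft ℂ A fun s => s + a

/-- The diagonal matrix `e^{± σ_z ∂}` of operators. -/
def expShift (n : ℤ) : Matrix (Fin 2) (Fin 2) (Module.End ℂ (ℂ → A)) :=
  Matrix.diagonal fun i => shiftOp ((n * sgn i : ℤ) : ℂ)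

/-- A matrix-valued function of the dynamical parameter, as a matrix of multiplication
operators. -/
def mulOp (M : ℂ → Matrix (Fin 2) (Fin 2) A) :
    Matrix (Fin 2) (Fin 2) (Module.End ℂ (ℂ → A)) :=
  Matrix.of fun i j => LinearMap.mulLeft ℂ fun s => M s i j

/-- `tr (N(λ) e^{-σ_z ∂} M(λ) e^{σ_z ∂})` is the operator of multiplication by `dynTrace`. -/
theorem trace_eq_mulLeft_dynTrace (q p : ℂ) (M : ℂ → Matrix (Fin 2) (Fin 2) A) :
    (mulOp (fun s => Matrix.diagonal fun i => algebraMap ℂ A (NDiag q p s i)) * expShift (-1)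
      * mulOp M * expShift 1).trace = LinearMap.mulLeft ℂ (dynTrace q p M) := by
  refine LinearMap.ext fun φ => funext fun s => ?_
  simp [Matrix.trace, Matrix.mul_apply, Fin.sum_univ_two, mulOp, expShift, shiftOp, dynTrace,
    LinearMap.funLeft, Matrix.diagonal, sgn, Algebra.smul_def, mul_assoc, add_mul, sub_eq_add_neg]

end Trace

/-- `t(z, λ) = tr (N(λ) e^{-σ_z ∂} L⁺(q^{-c} z, λ)⁻¹ L⁻(z, λ) e^{σ_z ∂})`. -/
def tGen (q p κ : ℂ) (c : ℤ) (z s : ℂ) : BAlg q p κ c :=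
  dynTrace q p (fun u => laxInv q p κ c .plus (q ^ (-c) * z) u * lax q p κ c .minus z u) s

/-- `t*(z, λ) = tr (N(λ) e^{-σ_z ∂} L⁻(q^c z, λ)⁻¹ L⁺(z, λ) e^{σ_z ∂})`. -/
def tStarGen (q p κ : ℂ) (c : ℤ) (z s : ℂ) : BAlg q p κ c :=
  dynTrace q p (fun u => laxInv q p κ c .minus (q ^ c * z) u * lax q p κ c .plus z u) s

end DynamicalElliptic

end

noncomputable section

namespace DynamicalElliptic

open Filter Topology

/-! ### Infinite products -/

/-! The heart of the matter is that at the critical charge the dynamical trace `T` passes through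
every Lax matrix `K`, changing only its dynamical argument: `T(λ) K(λ)_ab = K(λ)_ab T(λ + σ_b)`,
with a matching rule for `K⁻¹`. A second trace is a sum of terms `N_i (X⁻¹)_ij Y_ji` at `λ - σ_i`.
Moving `T(λ)` past the first factor shifts its argument by `-σ_i`, and moving it past the second
shifts it back, so the two traces commute (`commute_dynTrace`).

To obtain the intertwining rule, write `T` as the trace of `X⁻¹ Y` and exchange `K` with `X` and
with `Y`. At `c = -2` (for `t`) and `c = 2` (for `t*`) both exchanges have the same spectral
argument in `R*`, so the factor depending on `h` cancels (`mul_mul_eq_of_exchange`). The arguments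
of `R` then differ exactly by `q^4`. What remains is a conjugation of `X⁻¹ Y` by `K` on one side,
and `X⁻¹ Y` between `R` and an inverse of `R` at arguments `u` and `q^4 u` on the other. Weighting
by `N` and tracing, the R-matrices contract to the identity by the crossing relation `Crossing`,
while `N(λ)` becomes `N(λ + σ_a)` (`sum_mul_dynTrace_mul`).

The crossing relation comes down to six scalar identities between theta functions. They rest on the
quasi-periodicity `rho_mul_theta` of the normalization and on the three-term relation
`theta_three_term`. The latter follows from the Jacobi triple product `theta_eq_tsum`: splitting a
product of two theta series by parity writes it as a 2×2 determinant (`theta_mul_theta`), and the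
three-term relation is the Plücker relation between such determinants. -/

theorem summable_norm_mul_pow {p : ℂ} (hp : ‖p‖ < 1) (z : ℂ) :
    Summable fun n : ℕ => ‖-(z * p ^ n)‖ := by
  simpa [norm_mul, norm_pow] using
    (summable_geometric_of_lt_one (norm_nonneg p) hp).mul_left ‖z‖

theorem summable_norm_mul_pow_mul_pow {p r : ℂ} (hp : ‖p‖ < 1) (hr : ‖r‖ < 1) (z : ℂ) :
    Summable fun n : ℕ × ℕ => ‖-(z * p ^ n.1 * r ^ n.2)‖ := by
  have h := ((summable_geometric_of_lt_one (norm_nonneg p) hp).mul_of_nonneg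
    (summable_geometric_of_lt_one (norm_nonneg r) hr) (fun n => by positivity)
    (fun n => by positivity)).mul_left ‖z‖
  simpa [norm_mul, norm_pow, mul_assoc] using h

theorem multipliable_poch {p : ℂ} (hp : ‖p‖ < 1) (z : ℂ) :
    Multipliable fun n : ℕ => 1 - z * p ^ n := by
  simpa [sub_eq_add_neg] using multipliable_one_add_of_summable (summable_norm_mul_pow hp z)

theorem multipliable_poch₂ {p r : ℂ} (hp : ‖p‖ < 1) (hr : ‖r‖ < 1) (z : ℂ) :
    Multipliable fun n : ℕ × ℕ => 1 - z * p ^ n.1 * r ^ n.2 := by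
  simpa [sub_eq_add_neg] using
    multipliable_one_add_of_summable (summable_norm_mul_pow_mul_pow hp hr z)

theorem poch_eq_mul {p : ℂ} (hp : ‖p‖ < 1) (z : ℂ) : poch p z = (1 - z) * poch p (p * z) := by
  have h : ∀ n : ℕ, 1 - z * p ^ (n + 1) = 1 - p * z * p ^ n := fun n => by ring
  unfold poch
  rw [tprod_eq_zero_mul']
  · simp only [h, pow_zero, mul_one]
  · simpa only [h] using multipliable_poch hp (p * z)

theorem poch_ne_zero {p z : ℂ} (hp : ‖p‖ < 1) (hz : ∀ n : ℕ, z * p ^ n ≠ 1) : poch p z ≠ 0 := by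
  have h := tprod_one_add_ne_zero_of_summable (f := fun n : ℕ => -(z * p ^ n))
    (fun n => by rw [← sub_eq_add_neg]; exact sub_ne_zero.2 (hz n).symm)
    (summable_norm_mul_pow hp z)
  simpa [poch, sub_eq_add_neg] using h

theorem poch₂_ne_zero {p r z : ℂ} (hp : ‖p‖ < 1) (hr : ‖r‖ < 1)
    (hz : ∀ m n : ℕ, z * p ^ m * r ^ n ≠ 1) : poch₂ p r z ≠ 0 := by
  have h := tprod_one_add_ne_zero_of_summable (f := fun n : ℕ × ℕ => -(z * p ^ n.1 * r ^ n.2))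
    (fun n => by rw [← sub_eq_add_neg]; exact sub_ne_zero.2 (hz n.1 n.2).symm)
    (summable_norm_mul_pow_mul_pow hp hr z)
  simpa [poch₂, sub_eq_add_neg] using h

theorem hasProd_poch₂ {p r : ℂ} (hp : ‖p‖ < 1) (hr : ‖r‖ < 1) (z : ℂ) :
    HasProd (fun n : ℕ => poch p (z * r ^ n)) (poch₂ p r z) := by
  have h := (Equiv.prodComm ℕ ℕ).hasProd_iff.2 (multipliable_poch₂ hp hr z).hasProd
  refine h.prod_fiberwise fun n => ?_
  have e : ∀ m : ℕ, 1 - z * p ^ m * r ^ n = 1 - z * r ^ n * p ^ m := fun m => by ring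
  simpa [Function.comp_def, e, poch] using (multipliable_poch hp (z * r ^ n)).hasProd

/-- Grouping the double product by the exponent of `r` and splitting off exponent `0` leaves a
single product with nome `p`. With `r = q^4`, this is the source of the theta functions in the
quasi-periodicity of `rho`. -/
theorem poch₂_eq_mul {p r : ℂ} (hp : ‖p‖ < 1) (hr : ‖r‖ < 1) (z : ℂ) :
    poch₂ p r z = poch p z * poch₂ p r (r * z) := by
  have e : ∀ n : ℕ, poch p (z * r ^ (n + 1)) = poch p (r * z * r ^ n) := fun n => by ring_nf
  have h := hasProd_poch₂ hp hr (r * z)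
  rw [← (hasProd_poch₂ hp hr z).tprod_eq, ← h.tprod_eq, tprod_eq_zero_mul']
  · simp only [e, pow_zero, mul_one]
  · simpa only [e] using h.multipliable

/-! ### The Jacobi triple product -/

/-- `(p;p)_n = ∏_{k < n} (1 - p^{k+1})`. -/
def qPoch (p : ℂ) (n : ℕ) : ℂ := ∏ k ∈ Finset.range n, (1 - p ^ (k + 1))

theorem qPoch_succ (p : ℂ) (n : ℕ) : qPoch p (n + 1) = qPoch p n * (1 - p ^ (n + 1)) :=
  Finset.prod_range_succ _ _

theorem pow_succ_ne_one {p : ℂ} (hp : ‖p‖ < 1) (n : ℕ) : p ^ (n + 1) ≠ 1 := by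
  intro h
  have := congrArg norm h
  rw [norm_pow, norm_one] at this
  exact (pow_lt_one₀ (norm_nonneg p) hp (Nat.succ_ne_zero n)).ne this

theorem qPoch_ne_zero {p : ℂ} (hp : ‖p‖ < 1) (n : ℕ) : qPoch p n ≠ 0 :=
  Finset.prod_ne_zero_iff.2 fun k _ => sub_ne_zero.2 (pow_succ_ne_one hp k).symm

theorem poch_self_ne_zero {p : ℂ} (hp : ‖p‖ < 1) : poch p p ≠ 0 :=
  poch_ne_zero hp fun n => by rw [← pow_succ']; exact pow_succ_ne_one hp n

theorem tendsto_qPoch {p : ℂ} (hp : ‖p‖ < 1) : Tendsto (qPoch p) atTop (𝓝 (poch p p)) := by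
  have h := (multipliable_poch hp p).tendsto_prod_tprod_nat
  simp only [← pow_succ'] at h
  have e : poch p p = ∏' n : ℕ, (1 - p ^ (n + 1)) := by simp only [poch, ← pow_succ']
  rw [e]
  exact h

/-- Gaussian binomial coefficients. -/
def gaussBinom (p : ℂ) : ℕ → ℕ → ℂ
  | _, 0 => 1
  | 0, _ + 1 => 0
  | n + 1, k + 1 => p ^ (k + 1) * gaussBinom p n (k + 1) + gaussBinom p n k

theorem gaussBinom_zero_right (p : ℂ) (n : ℕ) : gaussBinom p n 0 = 1 := by
  cases n <;> rfl

theorem gaussBinom_eq_zero (p : ℂ) : ∀ {n k : ℕ}, n < k → gaussBinom p n k = 0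
  | 0, k + 1, _ => rfl
  | n + 1, k + 1, h => by
    rw [gaussBinom, gaussBinom_eq_zero p (show n < k + 1 by omega),
      gaussBinom_eq_zero p (show n < k by omega)]
    simp

/-- The closed form of the Gaussian binomial, kept free of division so that it follows from the
Pascal rule for every `p`. It gives both the uniform bound and the limit needed for the triple
product. -/
theorem gaussBinom_mul_qPoch (p : ℂ) :
    ∀ m k : ℕ, gaussBinom p (m + k) k * (qPoch p k * qPoch p m) = qPoch p (m + k)
  | m, 0 => by simp [gaussBinom_zero_right, qPoch]
  | 0, k + 1 => by
    have h := gaussBinom_mul_qPoch p 0 k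
    rw [zero_add] at h ⊢
    rw [gaussBinom, gaussBinom_eq_zero p (Nat.lt_succ_self k), qPoch_succ]
    linear_combination (1 - p ^ (k + 1)) * h
  | m + 1, k + 1 => by
    have h₁ := gaussBinom_mul_qPoch p m (k + 1)
    have h₂ := gaussBinom_mul_qPoch p (m + 1) k
    have e : m + 1 + (k + 1) = m + 1 + k + 1 := by ring
    have e' : m + (k + 1) = m + 1 + k := by ring
    rw [e'] at h₁
    rw [e, gaussBinom, qPoch_succ p (m + 1 + k)]
    rw [qPoch_succ p m] at h₂ ⊢
    rw [qPoch_succ p k] at h₁ ⊢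
    linear_combination p ^ (k + 1) * (1 - p ^ (m + 1)) * h₁ + (1 - p ^ (k + 1)) * h₂
  termination_by m k => (m + k, k)

/-- Cauchy's q-binomial theorem. Splitting off the factor `k = 0` turns the rest into the same
product at `p * y`, so the induction must quantify over `y`; comparing coefficients is then the
Pascal rule. -/
theorem prod_one_sub_mul_pow (p : ℂ) (n : ℕ) : ∀ y : ℂ,
    ∏ k ∈ Finset.range n, (1 - y * p ^ k) =
      ∑ j ∈ Finset.range (n + 1), (-y) ^ j * p ^ (j.choose 2) * gaussBinom p n j := by
  induction n with
  | zero => intro y; simp [gaussBinom]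
  | succ n ih =>
    intro y
    have h := ih (p * y)
    have e : ∀ k : ℕ, 1 - y * p ^ (k + 1) = 1 - p * y * p ^ k := fun k => by ring
    rw [Finset.prod_range_succ']
    simp only [e, h, pow_zero, mul_one]
    rw [Finset.sum_range_succ' _ (n + 1)]
    have e₁ : ∀ j : ℕ, (-y) ^ (j + 1) * p ^ ((j + 1).choose 2) * gaussBinom p (n + 1) (j + 1)
        = (-(p * y)) ^ (j + 1) * p ^ ((j + 1).choose 2) * gaussBinom p n (j + 1)
          + -y * ((-(p * y)) ^ j * p ^ (j.choose 2) * gaussBinom p n j) := by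
      intro j
      rw [gaussBinom, Nat.choose_succ_succ' j 1, Nat.choose_one_right]
      simp only [pow_add, neg_mul_eq_mul_neg, mul_pow]
      ring
    simp only [e₁, Finset.sum_add_distrib, ← Finset.mul_sum]
    have e₂ := Finset.sum_range_succ'
      (fun j => (-(p * y)) ^ j * p ^ (j.choose 2) * gaussBinom p n j) (n + 1)
    rw [Finset.sum_range_succ, gaussBinom_eq_zero p (Nat.lt_succ_self n), mul_zero, add_zero] at e₂
    simp only [gaussBinom_zero_right, pow_zero, Nat.choose_zero_succ, mul_one] at e₂ ⊢
    linear_combination e₂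

/-- The triangular number `m (m - 1) / 2`. -/
def tri (m : ℤ) : ℤ := m * (m - 1) / 2

theorem two_mul_tri (m : ℤ) : 2 * tri m = m * (m - 1) :=
  Int.mul_ediv_cancel' (Int.even_mul_pred_self m).two_dvd

theorem tri_natCast (j : ℕ) : tri j = (j.choose 2 : ℕ) := by
  have h := two_mul_tri j
  have h' : 2 * j.choose 2 = j * (j - 1) := by
    rw [Nat.choose_two_right]
    exact Nat.mul_div_cancel' (Nat.even_mul_pred_self j).two_dvd
  rcases j with _ | j
  · simp [tri]
  · have h'' : (2 : ℤ) * ((j + 1).choose 2 : ℕ) = (j + 1) * j := by exact_mod_cast h'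
    push_cast at h ⊢
    linarith

/-- The general term of the theta series. -/
def thetaTerm (p z : ℂ) (m : ℤ) : ℂ := (-z) ^ m * p ^ tri m

theorem summable_thetaTerm {p z : ℂ} (hp₀ : p ≠ 0) (hp : ‖p‖ < 1) (hz : z ≠ 0) :
    Summable (thetaTerm p z) := by
  have hπ : (2 * Real.pi * Complex.I : ℂ) ≠ 0 := Complex.two_pi_I_ne_zero
  have him : 0 < (Complex.log p / (2 * Real.pi * Complex.I)).im := by
    have e : Complex.log p / (2 * Real.pi * Complex.I)
        = -(Complex.log p * Complex.I) / ((2 * Real.pi : ℝ) : ℂ) := by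
      have h2 : (Real.pi : ℂ) ≠ 0 := by exact_mod_cast Real.pi_ne_zero
      push_cast
      field_simp
      rw [Complex.I_sq]; ring
    rw [e, Complex.div_ofReal_im]
    have : Real.log ‖p‖ < 0 := Real.log_neg (norm_pos_iff.2 hp₀) hp
    refine div_pos ?_ (by positivity)
    simpa [Complex.log_re] using this
  -- With `p = exp(2πiτ)` the term is `exp(πi m² τ + 2πi m v)`. Subtracting `log p / 2` in `v`
  -- accounts for the linear part of `m(m-1)/2`, and `‖p‖ < 1` is the condition `Im τ > 0`.
  refine ((summable_jacobiTheta₂_term_iff ((Complex.log (-z) - Complex.log p / 2)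
    / (2 * Real.pi * Complex.I)) _).2 him).congr fun m => ?_
  have ht : ((tri m : ℤ) : ℂ) = m * (m - 1) / 2 := by
    have := congrArg (Int.cast : ℤ → ℂ) (two_mul_tri m)
    push_cast at this
    linear_combination this / 2
  rw [jacobiTheta₂_term, thetaTerm]
  conv_rhs => rw [← Complex.exp_log (neg_ne_zero.2 hz), ← Complex.exp_log hp₀,
    ← Complex.exp_int_mul, ← Complex.exp_int_mul, ← Complex.exp_add, ht]
  congr 1
  field_simp
  ring

/-- The Gaussian binomial coefficient `[2n, n + m]`, extended by zero. -/
def centralBinom (p : ℂ) (n : ℕ) (m : ℤ) : ℂ :=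
  if -(n : ℤ) ≤ m then gaussBinom p (2 * n) (n + m).toNat else 0

/-- The finite form of the Jacobi triple product: the q-binomial theorem for `2n` factors, recentred
so that the summation index `j = n + m` becomes symmetric about `0`. -/
theorem prod_eq_tsum_centralBinom {p z : ℂ} (hp₀ : p ≠ 0) (hz : z ≠ 0) (n : ℕ) :
    (∏ k ∈ Finset.range n, (1 - z * p ^ k)) * ∏ k ∈ Finset.range n, (1 - p * z⁻¹ * p ^ k) =
      ∑' m : ℤ, thetaTerm p z m * centralBinom p n m := by
  have h₀ : (∏ k ∈ Finset.range n, (1 - z * p ^ (-(n : ℤ)) * p ^ k))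
      = ∏ k ∈ Finset.range n, (1 - z * p ^ (-((k : ℤ) + 1))) := by
    rw [← Finset.prod_range_reflect]
    refine Finset.prod_congr rfl fun k hk => ?_
    have hk := Finset.mem_range.1 hk
    rw [mul_assoc, ← zpow_natCast, ← zpow_add₀ hp₀]
    congr 3
    omega
  -- Each factor flips as `1 - p^(k+1)/z = (-z)⁻¹ p^(k+1) (1 - z p^(-(k+1)))`; the exponents of `p`
  -- add up to `n(n+1)/2 = tri (n + 1)`.
  have h₁ : ∀ n : ℕ, (∏ k ∈ Finset.range n, (1 - p * z⁻¹ * p ^ k)) =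
      (-z) ^ (-(n : ℤ)) * p ^ tri (n + 1) *
        ∏ k ∈ Finset.range n, (1 - z * p ^ (-((k : ℤ) + 1))) := by
    intro n
    induction n with
    | zero => simp [tri]
    | succ n ih =>
      have ht : tri ((n + 1 : ℕ) + 1) = tri (n + 1) + (n + 1) := by
        have h₁ := two_mul_tri ((n + 1 : ℕ) + 1)
        have h₂ := two_mul_tri (n + 1)
        push_cast at h₁ ⊢
        linarith
      have hn : -((n + 1 : ℕ) : ℤ) = -(n : ℤ) + -1 := by push_cast; ring
      have hpn : p ^ ((n : ℤ) + 1) ≠ 0 := zpow_ne_zero _ hp₀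
      rw [Finset.prod_range_succ, Finset.prod_range_succ, ih, ht, hn,
        zpow_add₀ (neg_ne_zero.2 hz), zpow_add₀ hp₀ (tri _), zpow_neg_one, zpow_neg p]
      have e : 1 - p * z⁻¹ * p ^ n
          = (-z)⁻¹ * p ^ ((n : ℤ) + 1) * (1 - z * (p ^ ((n : ℤ) + 1))⁻¹) := by
        rw [mul_sub, mul_one, ← mul_assoc, mul_right_comm _ _ (p ^ ((n : ℤ) + 1))⁻¹,
          mul_assoc (-z)⁻¹, mul_inv_cancel₀ hpn]
        rw [zpow_add_one₀ hp₀, zpow_natCast]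
        field_simp
        ring
      rw [e]
      ring
  -- Starting at `z * p^(-n)` makes the first `n` factors the flipped ones and the last `n` the
  -- factors `1 - z p^k`.
  have hb := prod_one_sub_mul_pow p (n + n) (z * p ^ (-(n : ℤ)))
  rw [Finset.prod_range_add, h₀] at hb
  have e₂ : ∀ k : ℕ, z * p ^ (-(n : ℤ)) * p ^ (n + k) = z * p ^ k := fun k => by
    rw [mul_assoc, ← zpow_natCast, ← zpow_add₀ hp₀, ← zpow_natCast]
    congr 2
    push_cast
    ring
  simp only [e₂] at hb
  rw [h₁ n, mul_left_comm, mul_comm (∏ k ∈ Finset.range n, (1 - z * p ^ k)), mul_assoc, hb,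
    Finset.mul_sum, Finset.mul_sum]
  let ι : ℕ ↪ ℤ := ⟨fun j => (j : ℤ) - n, fun a b h => by simpa using h⟩
  rw [tsum_eq_sum (s := (Finset.range (n + n + 1)).map ι), Finset.sum_map]
  · refine Finset.sum_congr rfl fun j _ => ?_
    have e₃ : centralBinom p n ((j : ℤ) - n) = gaussBinom p (n + n) j := by
      rw [centralBinom, if_pos (by omega), two_mul]
      congr 1
      omega
    have e₄ : tri ((j : ℤ) - n) = tri (n + 1) + (-(n : ℤ) * j + tri j) := by
      have h₁ := two_mul_tri ((j : ℤ) - n)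
      have h₂ := two_mul_tri ((n : ℤ) + 1)
      have h₃ := two_mul_tri j
      linarith
    change _ = thetaTerm p z ((j : ℤ) - n) * centralBinom p n ((j : ℤ) - n)
    rw [e₃, thetaTerm, e₄, zpow_add₀ hp₀, zpow_add₀ hp₀, zpow_mul, tri_natCast, zpow_natCast,
      zpow_natCast, sub_eq_neg_add, zpow_add₀ (neg_ne_zero.2 hz), zpow_natCast, ← neg_mul, mul_pow]
    ring
  · intro m hm
    rw [centralBinom]
    split_ifs with h
    · rw [gaussBinom_eq_zero, mul_zero]
      by_contra h'
      refine hm (Finset.mem_map.2 ⟨(n + m).toNat, Finset.mem_range.2 (by omega), ?_⟩)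
      change ((n + m).toNat : ℤ) - n = m
      omega
    · rw [mul_zero]

/-- In the closed form, `(p;p)_n` and its inverse converge to finite limits and are therefore
bounded. A bound uniform in both indices supplies the dominating series in the triple product. -/
theorem norm_gaussBinom_le {p : ℂ} (hp : ‖p‖ < 1) :
    ∃ C : ℝ, ∀ n k : ℕ, ‖gaussBinom p n k‖ ≤ C := by
  obtain ⟨a, ha⟩ := (tendsto_qPoch hp).norm.bddAbove_range
  obtain ⟨b, hb⟩ := ((tendsto_qPoch hp).inv₀ (poch_self_ne_zero hp)).norm.bddAbove_range
  have ha' : ∀ n, ‖qPoch p n‖ ≤ a := fun n => ha ⟨n, rfl⟩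
  have hb' : ∀ n, ‖(qPoch p n)⁻¹‖ ≤ b := fun n => hb ⟨n, rfl⟩
  have ha0 : 0 ≤ a := (norm_nonneg _).trans (ha' 0)
  have hb0 : 0 ≤ b := (norm_nonneg _).trans (hb' 0)
  refine ⟨a * (b * b), fun n k => ?_⟩
  rcases lt_or_ge n k with h | h
  · rw [gaussBinom_eq_zero p h, norm_zero]; positivity
  · obtain ⟨m, rfl⟩ := Nat.exists_eq_add_of_le' h
    have e : gaussBinom p (m + k) k = qPoch p (m + k) * ((qPoch p k)⁻¹ * (qPoch p m)⁻¹) := by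
      rw [← gaussBinom_mul_qPoch p m k]
      have := qPoch_ne_zero hp k
      have := qPoch_ne_zero hp m
      field_simp
    rw [e, norm_mul, norm_mul]
    gcongr
    exacts [ha' _, hb' _, hb' _]

theorem tendsto_centralBinom {p : ℂ} (hp : ‖p‖ < 1) (m : ℤ) :
    Tendsto (fun n => centralBinom p n m) atTop (𝓝 (poch p p)⁻¹) := by
  have hP := poch_self_ne_zero hp
  have t₁ : Tendsto (fun n : ℕ => (n + m).toNat) atTop atTop :=
    tendsto_atTop.2 fun b => by
      filter_upwards [eventually_ge_atTop (b + m.natAbs)] with n hn; omega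
  have t₂ : Tendsto (fun n : ℕ => (n - m).toNat) atTop atTop :=
    tendsto_atTop.2 fun b => by
      filter_upwards [eventually_ge_atTop (b + m.natAbs)] with n hn; omega
  have t₃ : Tendsto (fun n : ℕ => 2 * n) atTop atTop :=
    tendsto_atTop.2 fun b => by
      filter_upwards [eventually_ge_atTop b] with n hn; omega
  have h := ((tendsto_qPoch hp).comp t₃).div
    (((tendsto_qPoch hp).comp t₁).mul ((tendsto_qPoch hp).comp t₂)) (mul_ne_zero hP hP)
  have e : poch p p / (poch p p * poch p p) = (poch p p)⁻¹ := by field_simp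
  rw [e] at h
  refine h.congr' ?_
  filter_upwards [eventually_ge_atTop m.natAbs] with n hn
  have hn' : -(n : ℤ) ≤ m := by omega
  have e : 2 * n = (n - m).toNat + (n + m).toNat := by omega
  simp only [Pi.div_apply, Function.comp_apply, centralBinom, if_pos hn']
  rw [e, ← gaussBinom_mul_qPoch, mul_div_cancel_right₀]
  exact mul_ne_zero (qPoch_ne_zero hp _) (qPoch_ne_zero hp _)

/-- The Jacobi triple product: let `n → ∞` in the finite form under dominated convergence. Every
central coefficient tends to `1/(p;p)_∞`, which the third factor of `theta` cancels. -/
theorem theta_eq_tsum {p z : ℂ} (hp₀ : p ≠ 0) (hp : ‖p‖ < 1) (hz : z ≠ 0) :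
    theta p z = ∑' m : ℤ, thetaTerm p z m := by
  have hP := poch_self_ne_zero hp
  have h₁ := (multipliable_poch hp z).tendsto_prod_tprod_nat.mul
    (multipliable_poch hp (p * z⁻¹)).tendsto_prod_tprod_nat
  obtain ⟨C, hC⟩ := norm_gaussBinom_le hp
  have hC0 : 0 ≤ C := (norm_nonneg _).trans (hC 0 0)
  have h₂ : Tendsto (fun n : ℕ => ∑' m : ℤ, thetaTerm p z m * centralBinom p n m) atTop
      (𝓝 (∑' m : ℤ, thetaTerm p z m * (poch p p)⁻¹)) := by
    refine tendsto_tsum_of_dominated_convergence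
      (bound := fun m => ‖thetaTerm p z m‖ * C) ((summable_thetaTerm hp₀ hp hz).norm.mul_right C)
      (fun m => (tendsto_centralBinom hp m).const_mul _) (Eventually.of_forall fun n m => ?_)
    rw [norm_mul]
    gcongr
    unfold centralBinom
    split_ifs
    · exact hC _ _
    · simpa using hC0
  simp only [prod_eq_tsum_centralBinom hp₀ hz] at h₁
  have h := tendsto_nhds_unique h₁ h₂
  rw [tsum_mul_right] at h
  rw [theta, poch, poch, h, mul_assoc, inv_mul_cancel₀ hP, mul_one]

/-! ### The three-term relation -/

/-- The even part `∑ p^{k²} y^{2k}` of the theta series. -/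
def thetaEven (p y : ℂ) : ℂ := ∑' k : ℤ, thetaTerm (p ^ 2) (-(p * y ^ 2)) k

/-- The odd part `∑ p^{k² + k} y^{2k+1}` of the theta series. -/
def thetaOdd (p y : ℂ) : ℂ := ∑' k : ℤ, y * thetaTerm (p ^ 2) (-(p ^ 2 * y ^ 2)) k

/-- Pairs of integers, split by the parity of their sum. -/
theorem tsum_eq_tsum_parity {f : ℤ × ℤ → ℂ} (hf : Summable f) :
    ∑' a, f a = ∑' a : ℤ × ℤ, f (a.1 + a.2, a.1 - a.2)
      + ∑' a : ℤ × ℤ, f (a.1 + a.2 + 1, a.1 - a.2) := by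
  let φ : (ℤ × ℤ) ⊕ (ℤ × ℤ) → ℤ × ℤ :=
    Sum.elim (fun a => (a.1 + a.2, a.1 - a.2)) (fun a => (a.1 + a.2 + 1, a.1 - a.2))
  have hφ : Function.Bijective φ := by
    constructor
    · rintro (⟨a, b⟩ | ⟨a, b⟩) (⟨c, d⟩ | ⟨c, d⟩) h <;>
        simp only [φ, Sum.elim_inl, Sum.elim_inr, Prod.mk.injEq] at h
      · obtain ⟨rfl, rfl⟩ : a = c ∧ b = d := by omega
        rfl
      · omega
      · omega
      · obtain ⟨rfl, rfl⟩ : a = c ∧ b = d := by omega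
        rfl
    · rintro ⟨a, b⟩
      rcases Int.emod_two_eq_zero_or_one (a + b) with h | h
      · refine ⟨Sum.inl ((a + b) / 2, (a - b) / 2), ?_⟩
        simp only [φ, Sum.elim_inl, Prod.mk.injEq]
        omega
      · refine ⟨Sum.inr ((a + b) / 2, (a - b) / 2), ?_⟩
        simp only [φ, Sum.elim_inr, Prod.mk.injEq]
        omega
  have h := (Equiv.ofBijective φ hφ).summable_iff.2 hf
  rw [← (Equiv.ofBijective φ hφ).tsum_eq f]
  exact Summable.tsum_sum (h.comp_injective Sum.inl_injective) (h.comp_injective Sum.inr_injective)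

theorem thetaTerm_mul_thetaTerm {p x y : ℂ} (hp₀ : p ≠ 0) (hx : x ≠ 0) (hy : y ≠ 0) (m n : ℤ) :
    thetaTerm p (x * y) m * thetaTerm p (x / y) n
      = (-1) ^ (m + n) * x ^ (m + n) * y ^ (m - n) * p ^ (tri m + tri n) := by
  rw [thetaTerm, thetaTerm, neg_eq_neg_one_mul, neg_eq_neg_one_mul (x / y), mul_zpow, mul_zpow,
    mul_zpow, div_zpow, zpow_add₀ (by norm_num), zpow_add₀ hx, zpow_add₀ hp₀, zpow_sub₀ hy]
  ring

theorem thetaTerm_sq_neg {p y : ℂ} (hp₀ : p ≠ 0) (n : ℕ) (k : ℤ) :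
    thetaTerm (p ^ 2) (-(p ^ n * y ^ 2)) k = y ^ (2 * k) * p ^ (n * k + 2 * tri k) := by
  have e : p ^ 2 = p ^ (2 : ℤ) := by norm_cast
  rw [thetaTerm, neg_neg, mul_zpow, e, ← zpow_mul, zpow_add₀ hp₀, zpow_mul p n, zpow_natCast,
    zpow_mul y, zpow_ofNat]
  ring

/-- In the double series, the substitution `(m, n) = (k + l, k - l)`, or `(k + l + 1, k - l)` for
odd sum, diagonalizes the quadratic exponent, so each parity class factors into a series in `x`
times a series in `y`. Up to the factor `x`, the result is the determinant of the vectors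
`(thetaOdd, thetaEven)` at `x` and `y`. -/
theorem theta_mul_theta {p x y : ℂ} (hp₀ : p ≠ 0) (hp : ‖p‖ < 1) (hx : x ≠ 0) (hy : y ≠ 0) :
    theta p (x * y) * theta p (x / y)
      = x * (thetaOdd p x * thetaEven p y - thetaEven p x * thetaOdd p y) := by
  have hp2 : ‖p ^ 2‖ < 1 := by
    rw [norm_pow]; exact pow_lt_one₀ (norm_nonneg p) hp two_ne_zero
  have hp20 : p ^ 2 ≠ 0 := pow_ne_zero 2 hp₀
  have sE : ∀ y : ℂ, y ≠ 0 → Summable (thetaTerm (p ^ 2) (-(p * y ^ 2))) := fun y hy =>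
    summable_thetaTerm hp20 hp2 (neg_ne_zero.2 (mul_ne_zero hp₀ (pow_ne_zero 2 hy)))
  have sO : ∀ y : ℂ, y ≠ 0 → Summable fun k => y * thetaTerm (p ^ 2) (-(p ^ 2 * y ^ 2)) k :=
    fun y hy => (summable_thetaTerm hp20 hp2
      (neg_ne_zero.2 (mul_ne_zero hp20 (pow_ne_zero 2 hy)))).mul_left y
  have sT : ∀ z : ℂ, z ≠ 0 → Summable (thetaTerm p z) := fun z hz => summable_thetaTerm hp₀ hp hz
  -- For even sum the exponent of `p` is `k² - k + l²`, whereas `thetaOdd` carries `k² + k`; the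
  -- index shift by one reconciles them.
  have hshift : thetaOdd p x
      = ∑' k : ℤ, x * thetaTerm (p ^ 2) (-(p ^ 2 * x ^ 2)) (k - 1) :=
    ((Equiv.subRight (1 : ℤ)).tsum_eq fun k => x * thetaTerm (p ^ 2) (-(p ^ 2 * x ^ 2)) k).symm
  have sO' : Summable fun k : ℤ => x * thetaTerm (p ^ 2) (-(p ^ 2 * x ^ 2)) (k - 1) :=
    (Equiv.subRight (1 : ℤ)).summable_iff.2 (sO x hx)
  have hxy := mul_ne_zero hx hy
  have hxy' := div_ne_zero hx hy
  have hsum := summable_mul_of_summable_norm (sT _ hxy).norm (sT _ hxy').norm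
  have e₁ : ∀ a : ℤ × ℤ, thetaTerm p (x * y) (a.1 + a.2) * thetaTerm p (x / y) (a.1 - a.2)
      = x * ((x * thetaTerm (p ^ 2) (-(p ^ 2 * x ^ 2)) (a.1 - 1))
        * thetaTerm (p ^ 2) (-(p * y ^ 2)) a.2) := by
    rintro ⟨k, l⟩
    have h := thetaTerm_sq_neg (y := y) hp₀ 1 l
    rw [pow_one] at h
    rw [thetaTerm_mul_thetaTerm hp₀ hx hy, h, thetaTerm_sq_neg hp₀]
    have t : tri (k + l) + tri (k - l)
        = ((2 : ℕ) * (k - 1) + 2 * tri (k - 1)) + ((1 : ℕ) * l + 2 * tri l) := by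
      have h₁ := two_mul_tri (k + l)
      have h₂ := two_mul_tri (k - l)
      have h₃ := two_mul_tri (k - 1)
      have h₄ := two_mul_tri l
      push_cast
      linarith
    have t₁ : k + l + (k - l) = 2 * (k - 1) + 1 + 1 := by ring
    have t₂ : k + l - (k - l) = 2 * l := by ring
    have t₃ : Even (2 * (k - 1) + 1 + 1) := by use k; ring
    rw [t, t₁, t₂, zpow_add₀ hp₀, t₃.neg_one_zpow, zpow_add_one₀ hx, zpow_add_one₀ hx]
    ring
  have e₂ : ∀ a : ℤ × ℤ, thetaTerm p (x * y) (a.1 + a.2 + 1) * thetaTerm p (x / y) (a.1 - a.2)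
      = -x * (thetaTerm (p ^ 2) (-(p * x ^ 2)) a.1
        * (y * thetaTerm (p ^ 2) (-(p ^ 2 * y ^ 2)) a.2)) := by
    rintro ⟨k, l⟩
    have h := thetaTerm_sq_neg (y := x) hp₀ 1 k
    rw [pow_one] at h
    rw [thetaTerm_mul_thetaTerm hp₀ hx hy, h, thetaTerm_sq_neg hp₀]
    have t : tri (k + l + 1) + tri (k - l)
        = ((1 : ℕ) * k + 2 * tri k) + ((2 : ℕ) * l + 2 * tri l) := by
      have h₁ := two_mul_tri (k + l + 1)
      have h₂ := two_mul_tri (k - l)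
      have h₃ := two_mul_tri k
      have h₄ := two_mul_tri l
      push_cast
      linarith
    have t₁ : k + l + 1 + (k - l) = 2 * k + 1 := by ring
    have t₂ : k + l + 1 - (k - l) = 2 * l + 1 := by ring
    have t₃ : Odd (2 * k + 1) := ⟨k, rfl⟩
    rw [t, t₁, t₂, zpow_add₀ hp₀, t₃.neg_one_zpow, zpow_add_one₀ hx, zpow_add_one₀ hy]
    ring
  rw [theta_eq_tsum hp₀ hp hxy, theta_eq_tsum hp₀ hp hxy',
    tsum_mul_tsum_of_summable_norm (sT _ hxy).norm (sT _ hxy').norm, tsum_eq_tsum_parity hsum]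
  simp only [e₁, e₂, tsum_mul_left]
  rw [← tsum_mul_tsum_of_summable_norm sO'.norm (sE y hy).norm,
    ← tsum_mul_tsum_of_summable_norm (sE x hx).norm (sO y hy).norm, ← hshift]
  unfold thetaEven thetaOdd
  ring

/-- Weierstrass' three-term relation. -/
theorem theta_three_term {p x y u v : ℂ} (hp₀ : p ≠ 0) (hp : ‖p‖ < 1) (hx : x ≠ 0) (hy : y ≠ 0)
    (hu : u ≠ 0) (hv : v ≠ 0) :
    theta p (x * y) * theta p (x / y) * (theta p (u * v) * theta p (u / v))
      - theta p (x * v) * theta p (x / v) * (theta p (u * y) * theta p (u / y))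
      = u / y * (theta p (x * u) * theta p (x / u) * (theta p (y * v) * theta p (y / v))) := by
  -- All three products become products of 2×2 minors of the four vectors at `x, y, u, v`, with the
  -- common factor `x * u`. What is left is the Plücker relation.
  rw [theta_mul_theta hp₀ hp hx hy, theta_mul_theta hp₀ hp hu hv, theta_mul_theta hp₀ hp hx hv,
    theta_mul_theta hp₀ hp hu hy, theta_mul_theta hp₀ hp hx hu, theta_mul_theta hp₀ hp hy hv]
  field_simp
  ring

theorem theta_inv {p z : ℂ} (hp : ‖p‖ < 1) (hz : z ≠ 0) : theta p z⁻¹ = -z⁻¹ * theta p z := by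
  rw [theta, theta, inv_inv, poch_eq_mul hp z⁻¹, poch_eq_mul hp z]
  field_simp
  ring

/-! ### The lattice of zeros and poles -/

section Lattice

variable {q p : ℂ}

theorem lattice_mul (hq₀ : q ≠ 0) (hp₀ : p ≠ 0) {x y : ℂ} (hx : x ∈ lattice q p)
    (hy : y ∈ lattice q p) : x * y ∈ lattice q p := by
  obtain ⟨a, b, rfl⟩ := hx
  obtain ⟨c, d, rfl⟩ := hy
  refine ⟨a + c, b + d, ?_⟩
  rw [mul_add, zpow_add₀ hq₀, zpow_add₀ hp₀]
  ring

theorem lattice_inv {x : ℂ} (hx : x ∈ lattice q p) : x⁻¹ ∈ lattice q p := by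
  obtain ⟨a, b, rfl⟩ := hx
  refine ⟨-a, -b, ?_⟩
  rw [mul_neg, zpow_neg, zpow_neg, mul_inv]

theorem zpow_mem_lattice (a : ℤ) : q ^ (2 * a) ∈ lattice q p := ⟨a, 0, by simp⟩

theorem sq_mem_lattice : q ^ 2 ∈ lattice q p := by
  simpa using zpow_mem_lattice (q := q) (p := p) 1

theorem pow_four_mem_lattice : q ^ 4 ∈ lattice q p := ⟨2, 0, by simp⟩

theorem nome_mem_lattice : p ∈ lattice q p := ⟨0, 1, by simp⟩

theorem mul_mem_lattice_iff (hq₀ : q ≠ 0) (hp₀ : p ≠ 0) {x y : ℂ} (hx : x ∈ lattice q p) :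
    x * y ∈ lattice q p ↔ y ∈ lattice q p := by
  refine ⟨fun h => ?_, lattice_mul hq₀ hp₀ hx⟩
  have hx0 : x ≠ 0 := by
    obtain ⟨a, b, rfl⟩ := hx
    exact mul_ne_zero (zpow_ne_zero _ hq₀) (zpow_ne_zero _ hp₀)
  simpa [hx0] using lattice_mul hq₀ hp₀ (lattice_inv hx) h

theorem inv_mem_lattice_iff {x : ℂ} : x⁻¹ ∈ lattice q p ↔ x ∈ lattice q p :=
  ⟨fun h => by simpa using lattice_inv h, lattice_inv⟩

/-- The nomes differ by `q^(-2c)`, which lies in `q^{2ℤ}`. A single lattice thus governs the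
singularities of both `R` and `R*`. -/
theorem lattice_starNome (hq₀ : q ≠ 0) (c : ℤ) :
    lattice q (starNome q p c) = lattice q p := by
  ext x
  constructor
  · rintro ⟨a, b, rfl⟩
    refine ⟨a + -c * b, b, ?_⟩
    rw [starNome, mul_zpow, ← zpow_mul, mul_add, zpow_add₀ hq₀]
    ring_nf
  · rintro ⟨a, b, rfl⟩
    refine ⟨a + c * b, b, ?_⟩
    rw [starNome, mul_zpow, ← zpow_mul, mul_add, zpow_add₀ hq₀, mul_assoc,
      mul_left_comm (q ^ (2 * (c * b))), ← zpow_add₀ hq₀]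
    ring_nf
    simp

theorem theta_ne_zero (hp₀ : p ≠ 0) (hp : ‖p‖ < 1) {z : ℂ} (hz : z ≠ 0)
    (h : z ∉ lattice q p) : theta p z ≠ 0 := by
  refine mul_ne_zero (mul_ne_zero (poch_ne_zero hp fun n hn => h ?_)
    (poch_ne_zero hp fun n hn => h ?_)) (poch_self_ne_zero hp)
  · refine ⟨0, -(n : ℤ), ?_⟩
    rw [mul_zero, zpow_zero, one_mul, zpow_neg, zpow_natCast]
    exact eq_inv_of_mul_eq_one_left hn
  · refine ⟨0, n + 1, ?_⟩
    rw [mul_zero, zpow_zero, one_mul, zpow_add_one₀ hp₀, zpow_natCast]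
    field_simp at hn
    rw [← hn]; ring

theorem poch₂_pow_four_ne_zero (hq : ‖q‖ < 1) (hp : ‖p‖ < 1) {z : ℂ}
    (h : z ∉ lattice q p) : poch₂ p (q ^ 4) z ≠ 0 := by
  refine poch₂_ne_zero hp ?_ fun m n hn => h ?_
  · rw [norm_pow]; exact pow_lt_one₀ (norm_nonneg q) hq (by norm_num)
  · refine ⟨-(2 * n : ℤ), -(m : ℤ), ?_⟩
    rw [mul_assoc] at hn
    rw [eq_inv_of_mul_eq_one_left hn, mul_inv, mul_comm, zpow_neg, zpow_natCast,
      ← pow_mul, mul_neg, zpow_neg]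
    congr 2
    rw [← zpow_natCast]
    congr 1
    push_cast
    ring

theorem rho_ne_zero (hq₀ : q ≠ 0) (hq : ‖q‖ < 1) (hp₀ : p ≠ 0) (hp : ‖p‖ < 1) {z : ℂ}
    (h : z ∉ lattice q p) : rho q p z ≠ 0 := by
  have h' : z⁻¹ ∉ lattice q p := fun hz => h (inv_mem_lattice_iff.1 hz)
  have m := @mul_mem_lattice_iff q p hq₀ hp₀
  have h2 := @sq_mem_lattice q p
  have h4 := @pow_four_mem_lattice q p
  have hn := @nome_mem_lattice q p
  have k : ∀ {x y : ℂ}, x ∈ lattice q p → y ∉ lattice q p → x * y ∉ lattice q p :=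
    fun hx hy hxy => hy ((m hx).1 hxy)
  have P : ∀ {z : ℂ}, z ∉ lattice q p → poch₂ p (q ^ 4) z ≠ 0 := poch₂_pow_four_ne_zero hq hp
  refine mul_ne_zero ((Complex.cpow_ne_zero_iff).2 (Or.inl hq₀)) (div_ne_zero ?_ ?_)
  · exact mul_ne_zero (mul_ne_zero (pow_ne_zero 2 (P (k h2 h))) (P (k hn h')))
      (P (k (lattice_mul hq₀ hp₀ hn h4) h'))
  · exact mul_ne_zero (mul_ne_zero (pow_ne_zero 2 (P (k (lattice_mul hq₀ hp₀ hn h2) h'))) (P h))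
      (P (k h4 h))

/-- Under `u ↦ q^4 u` every double product in `rho` gains or loses one single product with nome `p`,
and these assemble into theta functions. This ratio of normalizations is what lets the crossing
relation hold on the nose, with no extra scalar. -/
theorem rho_mul_theta (hq₀ : q ≠ 0) (hq : ‖q‖ < 1) (hp₀ : p ≠ 0) (hp : ‖p‖ < 1) {u : ℂ}
    (hu : u ≠ 0) (h : u ∉ lattice q p) :
    rho q p u * (theta p u * theta p (q ^ 4 * u))
      = rho q p (q ^ 4 * u) * theta p (q ^ 2 * u) ^ 2 := by
  have h' : u⁻¹ ∉ lattice q p := fun hz => h (inv_mem_lattice_iff.1 hz)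
  have h2 := @sq_mem_lattice q p
  have h4 := @pow_four_mem_lattice q p
  have hn := @nome_mem_lattice q p
  have k : ∀ {x y : ℂ}, x ∈ lattice q p → y ∉ lattice q p → x * y ∉ lattice q p :=
    fun hx hy hxy => hy ((mul_mem_lattice_iff hq₀ hp₀ hx).1 hxy)
  have P : ∀ {z : ℂ}, z ∉ lattice q p → poch₂ p (q ^ 4) z ≠ 0 := poch₂_pow_four_ne_zero hq hp
  have hq4 : ‖q ^ 4‖ < 1 := by rw [norm_pow]; exact pow_lt_one₀ (norm_nonneg q) hq (by norm_num)
  have S := fun z => poch₂_eq_mul hp hq4 z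
  have e₁ := S u
  have e₂ := S (q ^ 2 * u)
  have e₃ := S (q ^ 4 * u)
  have e₄ := S (p * (q ^ 4 * u)⁻¹)
  have e₅ := S (p * u⁻¹)
  have e₆ := S (p * q ^ 2 * (q ^ 4 * u)⁻¹)
  have a₂ : q ^ 4 * (q ^ 2 * u) = q ^ 2 * (q ^ 4 * u) := by ring
  have a₄ : q ^ 4 * (p * (q ^ 4 * u)⁻¹) = p * u⁻¹ := by field_simp
  have a₅ : q ^ 4 * (p * u⁻¹) = p * q ^ 4 * u⁻¹ := by ring
  have a₆ : q ^ 4 * (p * q ^ 2 * (q ^ 4 * u)⁻¹) = p * q ^ 2 * u⁻¹ := by field_simp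
  have a₇ : p * (q ^ 2 * u)⁻¹ = p * q ^ 2 * (q ^ 4 * u)⁻¹ := by field_simp
  have a₈ : p * q ^ 4 * (q ^ 4 * u)⁻¹ = p * u⁻¹ := by field_simp
  rw [a₂] at e₂
  rw [a₄] at e₄
  rw [a₅] at e₅
  rw [a₆] at e₆
  have n₁ := P (k h4 h)
  have n₂ := P (k h4 (k h4 h))
  have n₃ : poch₂ p (q ^ 4) (p * q ^ 2 * u⁻¹) ≠ 0 := P (k (lattice_mul hq₀ hp₀ hn h2) h')
  have n₄ : poch₂ p (q ^ 4) (p * u⁻¹) ≠ 0 := P (k hn h')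
  have n₅ : poch₂ p (q ^ 4) (p * q ^ 4 * u⁻¹) ≠ 0 := P (k (lattice_mul hq₀ hp₀ hn h4) h')
  have n₆ : poch₂ p (q ^ 4) u ≠ 0 := P h
  have n₇ : poch₂ p (q ^ 4) (p * q ^ 2 * (q ^ 4 * u)⁻¹) ≠ 0 := by
    rw [← a₇]
    exact P (k hn fun hh => k h2 h (inv_mem_lattice_iff.1 hh))
  rw [rho, rho, theta, theta, theta, a₇, a₈]
  rw [e₁] at n₆ ⊢
  rw [e₂, e₄, e₅]
  rw [e₆] at n₇ ⊢
  rw [e₃] at n₁ n₆ ⊢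
  rw [e₅] at n₄
  -- Each double product is nonzero, hence so is the single product split off from it; these are
  -- denominators to be cleared.
  have c₁ := left_ne_zero_of_mul n₁
  have c₂ := left_ne_zero_of_mul n₄
  have c₃ := left_ne_zero_of_mul n₆
  have c₄ := left_ne_zero_of_mul n₇
  generalize q ^ (-(1 / 2) : ℂ) = r
  clear n₁ n₄ n₆ n₇ e₁ e₂ e₃ e₄ e₅ e₆
  generalize poch p (p * q ^ 2 * (q ^ 4 * u)⁻¹) = x₁ at *
  generalize poch p (p * (q ^ 4 * u)⁻¹) = x₂ at *
  generalize poch p (p * u⁻¹) = x₃ at *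
  generalize poch₂ p (q ^ 4) (p * q ^ 2 * u⁻¹) = x₄ at *
  generalize poch₂ p (q ^ 4) (p * q ^ 4 * u⁻¹) = x₅ at *
  generalize poch₂ p (q ^ 4) (q ^ 4 * (q ^ 4 * u)) = x₆ at *
  generalize poch₂ p (q ^ 4) (q ^ 2 * (q ^ 4 * u)) = x₇ at *
  field_simp

end Lattice

/-! ### Six-vertex matrices -/

/-- The six-vertex matrix with the given nonzero entries. -/
def sixVertex (r b c c' b' : ℂ) : Matrix (Fin 2 × Fin 2) (Fin 2 × Fin 2) ℂ :=
  (!![r, 0, 0, 0; 0, b, c, 0; 0, c', b', 0; 0, 0, 0, r] :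
    Matrix (Fin (2 * 2)) (Fin (2 * 2)) ℂ).submatrix finProdFinEquiv finProdFinEquiv

@[simp]
theorem sixVertex_apply (r b c c' b' : ℂ) (i a j e : Fin 2) :
    sixVertex r b c c' b' (i, a) (j, e) =
      ![![![![r, 0], ![0, 0]], ![![0, b], ![c, 0]]],
        ![![![0, c'], ![b', 0]], ![![0, 0], ![0, r]]]] i a j e := by
  fin_cases i <;> fin_cases a <;> fin_cases j <;> fin_cases e <;>
    simp [sixVertex, finProdFinEquiv]

/-- Weight conservation (the ice rule). It is what allows dynamical shifts by the weights of
incoming and outgoing legs to be traded for each other. -/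
theorem sixVertex_eq_zero (r b c c' b' : ℂ) {x y : Fin 2 × Fin 2}
    (h : sgn x.1 + sgn x.2 ≠ sgn y.1 + sgn y.2) : sixVertex r b c c' b' x y = 0 := by
  obtain ⟨i, a⟩ := x
  obtain ⟨j, e⟩ := y
  fin_cases i <;> fin_cases a <;> fin_cases j <;> fin_cases e <;> simp [sgn] at h ⊢

theorem sixVertex_mul (r b c c' b' t e f f' e' : ℂ) :
    sixVertex r b c c' b' * sixVertex t e f f' e' =
      sixVertex (r * t) (b * e + c * f') (b * f + c * e') (c' * e + b' * f')
        (c' * f + b' * e') := by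
  rw [sixVertex, sixVertex, sixVertex, Matrix.submatrix_mul_equiv]
  congr 1
  ext i j
  fin_cases i <;> fin_cases j <;> simp [Matrix.mul_apply, Fin.sum_univ_succ]

theorem sixVertex_one : sixVertex 1 1 0 0 1 = 1 := by
  ext ⟨i, a⟩ ⟨j, e⟩
  fin_cases i <;> fin_cases a <;> fin_cases j <;> fin_cases e <;> simp

theorem sixVertex_swap (r b c c' b' : ℂ) :
    (sixVertex r b c c' b').submatrix Prod.swap Prod.swap = sixVertex r b' c' c b := by
  ext ⟨i, a⟩ ⟨j, e⟩
  fin_cases i <;> fin_cases a <;> fin_cases j <;> fin_cases e <;> simp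

/-! ### Inverse and crossing symmetry of the R-matrix -/

theorem RMat_eq_sixVertex (q p z s : ℂ) :
    RMat q p z s = sixVertex (rho q p z)
      (rho q p z * bFun q p (dynW q s) z) (rho q p z * cFun q p (dynW q s) z)
      (rho q p z * cFun q p (dynW q s)⁻¹ z) (rho q p z * bFun q p (dynW q s)⁻¹ z) := by
  rw [RMat, sixVertex]
  ext x y
  rw [Matrix.smul_apply, Matrix.submatrix_apply, Matrix.submatrix_apply]
  generalize finProdFinEquiv x = i
  generalize finProdFinEquiv y = j
  fin_cases i <;> fin_cases j <;> simp

/-- The determinant `b b̄ - c c̄` of the middle block of the R-matrix. -/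
def detFun (q p z : ℂ) : ℂ := q ^ 2 * theta p (z / q ^ 2) / theta p (q ^ 2 * z)

/-- The inverse of the R-matrix. -/
def RInv (q p z s : ℂ) : Matrix (Fin 2 × Fin 2) (Fin 2 × Fin 2) ℂ :=
  let d := (rho q p z * detFun q p z)⁻¹
  sixVertex (rho q p z)⁻¹ (d * bFun q p (dynW q s)⁻¹ z) (-(d * cFun q p (dynW q s) z))
    (-(d * cFun q p (dynW q s)⁻¹ z)) (d * bFun q p (dynW q s) z)

theorem dynW_ne_zero {q : ℂ} (hq₀ : q ≠ 0) (s : ℂ) : dynW q s ≠ 0 :=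
  (Complex.cpow_ne_zero_iff).2 (Or.inl hq₀)

theorem dynW_add_intCast {q : ℂ} (hq₀ : q ≠ 0) (s : ℂ) (n : ℤ) :
    dynW q (s + n) = q ^ (2 * n) * dynW q s := by
  have : 2 * (s + n) = ((2 * n : ℤ) : ℂ) + 2 * s := by push_cast; ring
  rw [dynW, this, Complex.cpow_add _ _ hq₀, Complex.cpow_intCast, dynW]

section

variable {q p : ℂ}

/-- The three-term relation at `(x, y, u, v) = (q², w, z, 1)`. The dependence on `w` cancels. -/
theorem bFun_mul_sub_cFun_mul (hq₀ : q ≠ 0) (hp₀ : p ≠ 0) (hp : ‖p‖ < 1)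
    {w z : ℂ} (hw₀ : w ≠ 0) (hw : w ∉ lattice q p) (hz₀ : z ≠ 0)
    (hz : z ∉ lattice q p) :
    bFun q p w z * bFun q p w⁻¹ z - cFun q p w z * cFun q p w⁻¹ z = detFun q p z := by
  have h := theta_three_term hp₀ hp (pow_ne_zero 2 hq₀) hw₀ hz₀ one_ne_zero
  have n₁ := theta_ne_zero hp₀ hp hw₀ hw
  have n₂ := theta_ne_zero hp₀ hp (mul_ne_zero (pow_ne_zero 2 hq₀) hz₀)
    (fun hh => hz ((mul_mem_lattice_iff hq₀ hp₀ sq_mem_lattice).1 hh))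
  have h₁ : theta p (q ^ 2 / z) = -(q ^ 2 / z) * theta p (z / q ^ 2) := by
    rw [← inv_div, theta_inv hp (div_ne_zero hz₀ (pow_ne_zero 2 hq₀)), inv_div]
  simp only [mul_one, div_one] at h
  rw [h₁] at h
  rw [bFun, bFun, cFun, cFun, detFun, theta_inv hp hw₀, mul_comm w z, ← div_eq_mul_inv,
    inv_mul_eq_div]
  field_simp at h ⊢
  linear_combination -h

theorem detFun_ne_zero (hq₀ : q ≠ 0) (hp₀ : p ≠ 0) (hp : ‖p‖ < 1) {z : ℂ} (hz₀ : z ≠ 0) (hz : z ∉ lattice q p) : detFun q p z ≠ 0 := by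
  refine div_ne_zero (mul_ne_zero (pow_ne_zero 2 hq₀) (theta_ne_zero (q := q) hp₀ hp
    (div_ne_zero hz₀ (pow_ne_zero 2 hq₀)) fun hh => hz ?_))
    (theta_ne_zero (q := q) hp₀ hp (mul_ne_zero (pow_ne_zero 2 hq₀) hz₀) fun hh => hz ?_)
  · rw [div_eq_inv_mul] at hh
    exact (mul_mem_lattice_iff hq₀ hp₀ (lattice_inv sq_mem_lattice)).1 hh
  · exact (mul_mem_lattice_iff hq₀ hp₀ sq_mem_lattice).1 hh

theorem RMat_mul_RInv (hq₀ : q ≠ 0) (hq : ‖q‖ < 1) (hp₀ : p ≠ 0) (hp : ‖p‖ < 1)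
    {z s : ℂ} (hz₀ : z ≠ 0) (hz : z ∉ lattice q p)
    (hs : dynW q s ∉ lattice q p) : RMat q p z s * RInv q p z s = 1 := by
  have hd := bFun_mul_sub_cFun_mul hq₀ hp₀ hp (dynW_ne_zero hq₀ s) hs hz₀ hz
  have hd₀ := detFun_ne_zero hq₀ hp₀ hp hz₀ hz
  have hr := rho_ne_zero hq₀ hq hp₀ hp hz
  rw [RMat_eq_sixVertex, RInv, sixVertex_mul, ← sixVertex_one]
  generalize bFun q p (dynW q s)⁻¹ z = b' at *
  generalize cFun q p (dynW q s)⁻¹ z = c' at *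
  congr 1 <;> field_simp <;> first | linear_combination hd | ring

theorem RInv_mul_RMat (hq₀ : q ≠ 0) (hq : ‖q‖ < 1) (hp₀ : p ≠ 0) (hp : ‖p‖ < 1)
    {z s : ℂ} (hz₀ : z ≠ 0) (hz : z ∉ lattice q p)
    (hs : dynW q s ∉ lattice q p) : RInv q p z s * RMat q p z s = 1 :=
  mul_eq_one_comm.1 (RMat_mul_RInv hq₀ hq hp₀ hp hz₀ hz hs)

/-- `Υ(λ - 1) / Υ(λ)` in terms of `w`. -/
def nFun (q p w : ℂ) : ℂ := q * theta p (w / q ^ 2) / theta p w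

/-- The right side is `Υ(λ + 1) / Υ(λ)`. Hence `w ↦ w⁻¹` interchanges the two diagonal entries of
`N`, and half of the crossing identities follow from the other half. -/
theorem nFun_inv (hq₀ : q ≠ 0) (hp : ‖p‖ < 1) {w : ℂ} (hw₀ : w ≠ 0) :
    nFun q p w⁻¹ = q⁻¹ * theta p (q ^ 2 * w) / theta p w := by
  have hq2 := pow_ne_zero 2 hq₀
  have e : w⁻¹ / q ^ 2 = (q ^ 2 * w)⁻¹ := by field_simp
  rw [nFun, e, theta_inv hp (mul_ne_zero hq2 hw₀), theta_inv hp hw₀]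
  by_cases h : theta p w = 0
  · simp [h]
  · field_simp

theorem cpow_neg_sub (hq₀ : q ≠ 0) (s : ℂ) (n : ℤ) :
    q ^ (-(s - n)) = q ^ n * q ^ (-s) := by
  rw [show -(s - (n : ℂ)) = n + -s by ring, Complex.cpow_add _ _ hq₀, Complex.cpow_intCast]

theorem NDiag_zero (hq₀ : q ≠ 0) (s : ℂ) : NDiag q p s 0 = nFun q p (dynW q s) := by
  have h := dynW_add_intCast hq₀ s (-1)
  have h' := cpow_neg_sub hq₀ s 1
  have h₀ : q ^ (-s) ≠ 0 := (Complex.cpow_ne_zero_iff).2 (Or.inl hq₀)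
  have e : q ^ (2 * (-1) : ℤ) * dynW q s = dynW q s / q ^ 2 := by
    rw [mul_comm, div_eq_mul_inv]; congr 1
  rw [e] at h
  simp only [Int.cast_neg, Int.cast_one, ← sub_eq_add_neg, zpow_one] at h h'
  simp only [NDiag, upsilon, nFun, sgn, Matrix.cons_val_zero, Int.cast_one, h, h']
  rw [mul_comm q, mul_assoc, mul_div_mul_left _ _ h₀]

theorem NDiag_one (hq₀ : q ≠ 0) (hp : ‖p‖ < 1) (s : ℂ) :
    NDiag q p s 1 = nFun q p (dynW q s)⁻¹ := by
  have h := dynW_add_intCast hq₀ s 1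
  have h' := cpow_neg_sub hq₀ s (-1)
  have h₀ : q ^ (-s) ≠ 0 := (Complex.cpow_ne_zero_iff).2 (Or.inl hq₀)
  have e : q ^ (2 * 1 : ℤ) = q ^ 2 := rfl
  rw [e] at h
  rw [nFun_inv hq₀ hp (dynW_ne_zero hq₀ s)]
  simp only [Int.cast_neg, Int.cast_one, sub_neg_eq_add, zpow_neg_one] at h h'
  simp only [NDiag, upsilon, sgn, Matrix.cons_val_one,
    Matrix.cons_val_fin_one, Int.cast_neg, Int.cast_one, sub_neg_eq_add, h, h']
  rw [mul_comm q⁻¹, mul_assoc, mul_div_mul_left _ _ h₀]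

/-- The only crossing identity with two terms on one side and a nonzero value. After `rho_mul_theta`
removes the normalizations, it is the three-term relation at `(w, q², q² u, 1)`. -/
theorem nFun_crossing_corner (hq₀ : q ≠ 0) (hq : ‖q‖ < 1) (hp₀ : p ≠ 0) (hp : ‖p‖ < 1)
    {w u : ℂ} (hw₀ : w ≠ 0) (hw : w ∉ lattice q p) (hu₀ : u ≠ 0) (hu : u ∉ lattice q p) :
    nFun q p w * (rho q p u * (rho q p (q ^ 4 * u))⁻¹)
      - nFun q p w⁻¹ * (rho q p u * cFun q p (q ^ 2 * w) u
        * ((rho q p (q ^ 4 * u) * detFun q p (q ^ 4 * u))⁻¹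
          * cFun q p (q ^ 2 * w)⁻¹ (q ^ 4 * u))) = nFun q p (q ^ 2 * w) := by
  have hq2 := pow_ne_zero 2 hq₀
  have k : ∀ {x y : ℂ}, x ∈ lattice q p → y ∉ lattice q p → x * y ∉ lattice q p :=
    fun hx hy hxy => hy ((mul_mem_lattice_iff hq₀ hp₀ hx).1 hxy)
  have T : ∀ {z : ℂ}, z ≠ 0 → z ∉ lattice q p → theta p z ≠ 0 := theta_ne_zero hp₀ hp
  have h2 := @sq_mem_lattice q p
  have h4 := @pow_four_mem_lattice q p
  have h := theta_three_term hp₀ hp hw₀ hq2 (mul_ne_zero hq2 hu₀) one_ne_zero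
  have hr := rho_mul_theta hq₀ hq hp₀ hp hu₀ hu
  have r₁ := rho_ne_zero hq₀ hq hp₀ hp (k h4 hu)
  have a₁ : q ^ 2 * u * q ^ 2 = q ^ 4 * u := by ring
  have a₂ : q ^ 2 * u / q ^ 2 = u := by field_simp
  have a₃ : w * (q ^ 2 * u) = q ^ 2 * w * u := by ring
  have a₄ : theta p (w / (q ^ 2 * u)) = -(w / (q ^ 2 * u)) * theta p (q ^ 2 * u / w) := by
    rw [← inv_div, theta_inv hp (div_ne_zero (mul_ne_zero hq2 hu₀) hw₀), inv_div]
  have a₅ : (q ^ 2 * w)⁻¹ * (q ^ 4 * u) = q ^ 2 * u / w := by field_simp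
  have a₆ : q ^ 2 * (q ^ 4 * u) = q ^ 6 * u := by ring
  have a₇ : q ^ 4 * u / q ^ 2 = q ^ 2 * u := by field_simp
  have a₈ : q ^ 2 * w / q ^ 2 = w := by field_simp
  have n₁ := T hw₀ hw
  have n₂ := T (mul_ne_zero hq2 hw₀) (k h2 hw)
  have n₃ := T hu₀ hu
  have n₄ := T (mul_ne_zero hq2 hu₀) (k h2 hu)
  have n₅ := T (mul_ne_zero (pow_ne_zero 4 hq₀) hu₀) (k h4 hu)
  have n₆ : theta p (q ^ 6 * u) ≠ 0 := by
    rw [← a₆]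
    exact T (mul_ne_zero hq2 (mul_ne_zero (pow_ne_zero 4 hq₀) hu₀)) (k h2 (k h4 hu))
  have g : rho q p u
      = rho q p (q ^ 4 * u) * theta p (q ^ 2 * u) ^ 2 / (theta p u * theta p (q ^ 4 * u)) := by
    rw [← hr]; field_simp
  rw [a₁, a₂, a₃, a₄] at h
  simp only [mul_one, div_one] at h
  rw [nFun_inv hq₀ hp hw₀, g, nFun, nFun, cFun, cFun, detFun, a₅, a₆, a₇, a₈,
    theta_inv hp (mul_ne_zero hq2 hw₀), mul_comm w (q ^ 2)] at *
  clear a₁ a₂ a₃ a₄ a₅ a₆ a₇ a₈ g hr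
  generalize rho q p (q ^ 4 * u) = x₀ at *
  generalize theta p (q ^ 2 * u / w) = x₁ at *
  generalize theta p (w / q ^ 2) = x₂ at *
  generalize theta p (q ^ 2 * w * u) = x₃ at *
  generalize theta p (q ^ 2 * w) = x₄ at *
  generalize theta p (q ^ 2 * u) = x₅ at *
  generalize theta p (q ^ 4 * u) = x₆ at *
  generalize theta p (q ^ 6 * u) = x₇ at *
  generalize theta p (q ^ 2) = x₈ at *
  field_simp at h ⊢
  linear_combination h

/-- No addition formula is needed: once `rho_mul_theta` is inserted, all theta factors cancel in
pairs. -/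
theorem nFun_crossing_diag (hq₀ : q ≠ 0) (hq : ‖q‖ < 1) (hp₀ : p ≠ 0) (hp : ‖p‖ < 1)
    {w u : ℂ} (hw₀ : w ≠ 0) (hw : w ∉ lattice q p) (hu₀ : u ≠ 0) (hu : u ∉ lattice q p) :
    nFun q p w⁻¹ * (rho q p u * bFun q p (q ^ 2 * w) u
        * ((rho q p (q ^ 4 * u) * detFun q p (q ^ 4 * u))⁻¹
          * bFun q p (q ^ 2 * w)⁻¹ (q ^ 4 * u))) = nFun q p (q ^ 2 * w)⁻¹ := by
  have hq2 := pow_ne_zero 2 hq₀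
  have k : ∀ {x y : ℂ}, x ∈ lattice q p → y ∉ lattice q p → x * y ∉ lattice q p :=
    fun hx hy hxy => hy ((mul_mem_lattice_iff hq₀ hp₀ hx).1 hxy)
  have T : ∀ {z : ℂ}, z ≠ 0 → z ∉ lattice q p → theta p z ≠ 0 := theta_ne_zero hp₀ hp
  have h2 := @sq_mem_lattice q p
  have h4 := @pow_four_mem_lattice q p
  have hr := rho_mul_theta hq₀ hq hp₀ hp hu₀ hu
  have r₁ := rho_ne_zero hq₀ hq hp₀ hp (k h4 hu)
  have a₁ : q ^ 2 * (q ^ 2 * w)⁻¹ = w⁻¹ := by field_simp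
  have a₆ : q ^ 2 * (q ^ 4 * u) = q ^ 6 * u := by ring
  have a₇ : q ^ 4 * u / q ^ 2 = q ^ 2 * u := by field_simp
  have n₁ := T hw₀ hw
  have n₂ := T (mul_ne_zero hq2 hw₀) (k h2 hw)
  have n₃ := T hu₀ hu
  have n₄ := T (mul_ne_zero hq2 hu₀) (k h2 hu)
  have n₅ := T (mul_ne_zero (pow_ne_zero 4 hq₀) hu₀) (k h4 hu)
  have n₆ : theta p (q ^ 6 * u) ≠ 0 := by
    rw [← a₆]
    exact T (mul_ne_zero hq2 (mul_ne_zero (pow_ne_zero 4 hq₀) hu₀)) (k h2 (k h4 hu))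
  have g : rho q p u
      = rho q p (q ^ 4 * u) * theta p (q ^ 2 * u) ^ 2 / (theta p u * theta p (q ^ 4 * u)) := by
    rw [← hr]; field_simp
  rw [nFun_inv hq₀ hp hw₀, nFun_inv hq₀ hp (mul_ne_zero hq2 hw₀), g, bFun, bFun, detFun, a₁, a₆,
    a₇, theta_inv hp (mul_ne_zero hq2 hw₀), theta_inv hp hw₀]
  generalize theta p (q ^ 2 * (q ^ 2 * w)) = x₁ at *
  field_simp

/-- The factor `rho q p u` is common to both sides and the numerators `theta p (q ^ 2 * w * u)`
agree, so only cancellation of theta factors remains. -/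
theorem nFun_crossing_off (hq₀ : q ≠ 0) (hq : ‖q‖ < 1) (hp₀ : p ≠ 0) (hp : ‖p‖ < 1)
    {w u : ℂ} (hw₀ : w ≠ 0) (hw : w ∉ lattice q p) (hu₀ : u ≠ 0) (hu : u ∉ lattice q p) :
    nFun q p w⁻¹ * (rho q p u * cFun q p (q ^ 2 * w) u * (rho q p (q ^ 4 * u))⁻¹)
      = nFun q p w * (rho q p u * ((rho q p (q ^ 4 * u) * detFun q p (q ^ 4 * u))⁻¹
          * cFun q p (w / q ^ 2) (q ^ 4 * u))) := by
  have hq2 := pow_ne_zero 2 hq₀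
  have k : ∀ {x y : ℂ}, x ∈ lattice q p → y ∉ lattice q p → x * y ∉ lattice q p :=
    fun hx hy hxy => hy ((mul_mem_lattice_iff hq₀ hp₀ hx).1 hxy)
  have T : ∀ {z : ℂ}, z ≠ 0 → z ∉ lattice q p → theta p z ≠ 0 := theta_ne_zero hp₀ hp
  have h2 := @sq_mem_lattice q p
  have h4 := @pow_four_mem_lattice q p
  have r₁ := rho_ne_zero hq₀ hq hp₀ hp (k h4 hu)
  have a₁ : w / q ^ 2 * (q ^ 4 * u) = q ^ 2 * w * u := by field_simp
  have a₆ : q ^ 2 * (q ^ 4 * u) = q ^ 6 * u := by ring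
  have a₇ : q ^ 4 * u / q ^ 2 = q ^ 2 * u := by field_simp
  have n₁ := T hw₀ hw
  have n₂ := T (mul_ne_zero hq2 hw₀) (k h2 hw)
  have n₄ := T (mul_ne_zero hq2 hu₀) (k h2 hu)
  have n₆ : theta p (q ^ 6 * u) ≠ 0 := by
    rw [← a₆]
    exact T (mul_ne_zero hq2 (mul_ne_zero (pow_ne_zero 4 hq₀) hu₀)) (k h2 (k h4 hu))
  have n₇ : theta p (w / q ^ 2) ≠ 0 := by
    refine T (div_ne_zero hw₀ hq2) ?_
    rw [div_eq_inv_mul]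
    exact k (lattice_inv h2) hw
  rw [nFun_inv hq₀ hp hw₀, nFun, cFun, cFun, detFun, a₁, a₆, a₇]
  generalize theta p (w / q ^ 2) = x₁ at *
  generalize theta p (q ^ 2 * w * u) = x₂ at *
  generalize theta p (q ^ 2 * w) = x₃ at *
  field_simp

/-- The crossing relation that makes the dynamical trace invariant. -/
def Crossing (q p s : ℂ) (Q Q' : ℂ → Matrix (Fin 2 × Fin 2) (Fin 2 × Fin 2) ℂ) : Prop :=
  ∀ a b j k : Fin 2, ∑ i, ∑ e, NDiag q p s i *
      (Q (s - (sgn i : ℂ)) (i, a) (j, e) * Q' (s - (sgn i : ℂ)) (k, e) (i, b))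
    = if j = k ∧ a = b then NDiag q p (s + (sgn a : ℂ)) j else 0

theorem dynW_sub_sgn_zero (hq₀ : q ≠ 0) (s : ℂ) :
    dynW q (s - (sgn 0 : ℂ)) = dynW q s / q ^ 2 := by
  have h := dynW_add_intCast hq₀ s (-1)
  simp only [sgn, Matrix.cons_val_zero, Int.cast_one, sub_eq_add_neg]
  rw [div_eq_inv_mul]
  simpa using h

theorem dynW_sub_sgn_one (hq₀ : q ≠ 0) (s : ℂ) :
    dynW q (s - (sgn 1 : ℂ)) = q ^ 2 * dynW q s := by
  have h := dynW_add_intCast hq₀ s 1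
  simp only [sgn, Matrix.cons_val_one, Matrix.cons_val_fin_one]
  simpa using h

theorem dynW_add_sgn_zero (hq₀ : q ≠ 0) (s : ℂ) :
    dynW q (s + (sgn 0 : ℂ)) = q ^ 2 * dynW q s := by
  rw [← dynW_sub_sgn_one hq₀]
  simp [sgn]

theorem dynW_add_sgn_one (hq₀ : q ≠ 0) (s : ℂ) :
    dynW q (s + (sgn 1 : ℂ)) = dynW q s / q ^ 2 := by
  rw [← dynW_sub_sgn_zero hq₀]
  simp [sgn, sub_eq_add_neg]

/-- `bFun` is a function of `w` times a function of `z`, so spectral arguments may be exchanged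
between two factors. -/
theorem bFun_mul_bFun_comm (w v u z : ℂ) :
    bFun q p w u * bFun q p v z = bFun q p w z * bFun q p v u := by
  simp only [bFun, div_eq_mul_inv, mul_inv]
  ring

/-- By weight conservation only components with `sgn a + sgn k = sgn j + sgn b` can be nonzero. That
leaves six of the sixteen, one for each hypothesis `h₁` to `h₆`. -/
theorem crossing_of_sixVertex {s : ℂ} {Q Q' : ℂ → Matrix (Fin 2 × Fin 2) (Fin 2 × Fin 2) ℂ}
    {r r' : ℂ} {b c d e b' c' d' e' : Fin 2 → ℂ}
    (hQ : ∀ i, Q (s - (sgn i : ℂ)) = sixVertex r (b i) (c i) (d i) (e i))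
    (hQ' : ∀ i, Q' (s - (sgn i : ℂ)) = sixVertex r' (b' i) (c' i) (d' i) (e' i))
    (h₁ : NDiag q p s 0 * (r * r') + NDiag q p s 1 * (d 1 * c' 1)
      = NDiag q p (s + (sgn 0 : ℂ)) 0)
    (h₂ : NDiag q p s 0 * (c 0 * d' 0) + NDiag q p s 1 * (r * r')
      = NDiag q p (s + (sgn 1 : ℂ)) 1)
    (h₃ : NDiag q p s 1 * (e 1 * e' 1) = NDiag q p (s + (sgn 0 : ℂ)) 1)
    (h₄ : NDiag q p s 0 * (b 0 * b' 0) = NDiag q p (s + (sgn 1 : ℂ)) 0)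
    (h₅ : NDiag q p s 0 * (r * d' 0) + NDiag q p s 1 * (d 1 * r') = 0)
    (h₆ : NDiag q p s 0 * (c 0 * r') + NDiag q p s 1 * (r * c' 1) = 0) :
    Crossing q p s Q Q' := by
  intro a b j k
  simp only [hQ, hQ', sixVertex_apply]
  fin_cases a <;> fin_cases b <;> fin_cases j <;> fin_cases k <;>
    simp only [Fin.zero_eta, Fin.mk_one, Fin.sum_univ_two, Matrix.cons_val_zero,
      Matrix.cons_val_one, Matrix.cons_val_fin_one, mul_zero, zero_mul, add_zero, zero_add,
      and_self, and_true, if_true, if_false, zero_ne_one, one_ne_zero, and_false,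
      h₁, h₂, h₃, h₄, h₅, h₆]

/-- Three identities at `w` and the same three at `w⁻¹`, the latter exchanging the roles of the
indices `0` and `1`. -/
theorem crossing_scalars (hq₀ : q ≠ 0) (hq : ‖q‖ < 1) (hp₀ : p ≠ 0) (hp : ‖p‖ < 1) {s u : ℂ}
    (hs : dynW q s ∉ lattice q p) (hu₀ : u ≠ 0) (hu : u ∉ lattice q p) :
    let r := rho q p u
    let r' := (rho q p (q ^ 4 * u))⁻¹
    let d := (rho q p (q ^ 4 * u) * detFun q p (q ^ 4 * u))⁻¹
    let w₀ := dynW q (s - (sgn 0 : ℂ))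
    let w₁ := dynW q (s - (sgn 1 : ℂ))
    NDiag q p s 0 * (r * r')
        - NDiag q p s 1 * (r * cFun q p w₁ u * (d * cFun q p w₁⁻¹ (q ^ 4 * u)))
        = NDiag q p (s + (sgn 0 : ℂ)) 0 ∧
      NDiag q p s 1 * (r * r')
        - NDiag q p s 0 * (r * cFun q p w₀⁻¹ u * (d * cFun q p w₀ (q ^ 4 * u)))
        = NDiag q p (s + (sgn 1 : ℂ)) 1 ∧
      NDiag q p s 1 * (r * bFun q p w₁ u * (d * bFun q p w₁⁻¹ (q ^ 4 * u)))
        = NDiag q p (s + (sgn 0 : ℂ)) 1 ∧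
      NDiag q p s 0 * (r * bFun q p w₀⁻¹ u * (d * bFun q p w₀ (q ^ 4 * u)))
        = NDiag q p (s + (sgn 1 : ℂ)) 0 ∧
      NDiag q p s 1 * (r * cFun q p w₁ u * r')
        = NDiag q p s 0 * (r * (d * cFun q p w₀ (q ^ 4 * u))) ∧
      NDiag q p s 0 * (r * cFun q p w₀⁻¹ u * r')
        = NDiag q p s 1 * (r * (d * cFun q p w₁⁻¹ (q ^ 4 * u))) := by
  have hw₀ := dynW_ne_zero hq₀ s
  have hs' : (dynW q s)⁻¹ ∉ lattice q p := fun h => hs (inv_mem_lattice_iff.1 h)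
  have c₂ := nFun_crossing_corner hq₀ hq hp₀ hp (inv_ne_zero hw₀) hs' hu₀ hu
  have d₂ := nFun_crossing_diag hq₀ hq hp₀ hp (inv_ne_zero hw₀) hs' hu₀ hu
  have o₂ := nFun_crossing_off hq₀ hq hp₀ hp (inv_ne_zero hw₀) hs' hu₀ hu
  have e₁ : q ^ 2 * (dynW q s)⁻¹ = (dynW q s / q ^ 2)⁻¹ := by rw [inv_div, div_eq_mul_inv]
  have e₂ : (dynW q s)⁻¹ / q ^ 2 = (q ^ 2 * dynW q s)⁻¹ := by
    rw [mul_inv, div_eq_mul_inv, mul_comm]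
  rw [inv_inv, e₁] at c₂ d₂ o₂
  rw [inv_inv] at c₂ d₂
  rw [e₂] at o₂
  simp only [dynW_sub_sgn_zero hq₀, dynW_sub_sgn_one hq₀, NDiag_zero hq₀, NDiag_one hq₀ hp,
    dynW_add_sgn_zero hq₀, dynW_add_sgn_one hq₀]
  exact ⟨nFun_crossing_corner hq₀ hq hp₀ hp hw₀ hs hu₀ hu, c₂,
    nFun_crossing_diag hq₀ hq hp₀ hp hw₀ hs hu₀ hu, d₂,
    nFun_crossing_off hq₀ hq hp₀ hp hw₀ hs hu₀ hu, o₂⟩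

/-- The version for a Lax matrix in the first leg: flipping the legs exchanges the middle entries of
each six-vertex matrix and puts `R` to the left of its inverse. -/
theorem crossing_swap (hq₀ : q ≠ 0) (hq : ‖q‖ < 1) (hp₀ : p ≠ 0) (hp : ‖p‖ < 1) {s u : ℂ}
    (hs : dynW q s ∉ lattice q p) (hu₀ : u ≠ 0) (hu : u ∉ lattice q p) :
    Crossing q p s (fun t => (RMat q p u t).submatrix Prod.swap Prod.swap)
      (fun t => (RInv q p (q ^ 4 * u) t).submatrix Prod.swap Prod.swap) := by
  obtain ⟨h₁, h₂, h₃, h₄, h₅, h₆⟩ := crossing_scalars hq₀ hq hp₀ hp hs hu₀ hu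
  refine crossing_of_sixVertex
    (fun i => by simp only [RMat_eq_sixVertex]; exact sixVertex_swap _ _ _ _ _)
    (fun i => by simp only [RInv]; exact sixVertex_swap _ _ _ _ _) ?_ ?_ ?_ ?_ ?_ ?_
  · rw [← h₁]; ring
  · rw [← h₂]; ring
  · exact h₃
  · exact h₄
  · linear_combination h₅
  · linear_combination h₆

/-- The same six scalars serve with `R⁻¹` on the left: the diagonal ones after exchanging the
spectral arguments of the two `bFun` factors, and the two vanishing ones with their roles
interchanged. -/
theorem crossing (hq₀ : q ≠ 0) (hq : ‖q‖ < 1) (hp₀ : p ≠ 0) (hp : ‖p‖ < 1) {s u : ℂ}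
    (hs : dynW q s ∉ lattice q p) (hu₀ : u ≠ 0) (hu : u ∉ lattice q p) :
    Crossing q p s (RInv q p (q ^ 4 * u)) (RMat q p u) := by
  obtain ⟨h₁, h₂, h₃, h₄, h₅, h₆⟩ := crossing_scalars hq₀ hq hp₀ hp hs hu₀ hu
  refine crossing_of_sixVertex (fun i => rfl) (fun i => RMat_eq_sixVertex _ _ _ _)
    ?_ ?_ ?_ ?_ ?_ ?_
  · rw [← h₁]; ring
  · rw [← h₂]; ring
  · rw [← h₃]
    have := bFun_mul_bFun_comm (q := q) (p := p) (dynW q (s - (sgn 1 : ℂ)))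
      (dynW q (s - (sgn 1 : ℂ)))⁻¹ u (q ^ 4 * u)
    linear_combination (-NDiag q p s 1 * rho q p u *
      (rho q p (q ^ 4 * u) * detFun q p (q ^ 4 * u))⁻¹) * this
  · rw [← h₄]
    have := bFun_mul_bFun_comm (q := q) (p := p) (dynW q (s - (sgn 0 : ℂ)))
      (dynW q (s - (sgn 0 : ℂ)))⁻¹ u (q ^ 4 * u)
    linear_combination (NDiag q p s 0 * rho q p u *
      (rho q p (q ^ 4 * u) * detFun q p (q ^ 4 * u))⁻¹) * this
  · linear_combination h₆
  · linear_combination h₅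

end

/-! ### Invariance of the dynamical trace -/

section Legs

variable {A : Type*} [Ring A]

theorem leg₁_mul (M N : Matrix (Fin 2) (Fin 2) A) : leg₁ M * leg₁ N = leg₁ (M * N) := by
  ext ⟨i, a⟩ ⟨j, b⟩
  fin_cases a <;> fin_cases b <;>
    simp [leg₁, Matrix.mul_apply, Fintype.sum_prod_type, Fin.sum_univ_two]

theorem leg₁_one : leg₁ (1 : Matrix (Fin 2) (Fin 2) A) = 1 := by
  ext ⟨i, a⟩ ⟨j, b⟩
  simp [leg₁, Matrix.one_apply, Prod.mk.injEq, ← ite_and, and_comm]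

theorem leg₁Shift_mul (M N : ℂ → Matrix (Fin 2) (Fin 2) A) (s : ℂ) :
    leg₁Shift M s * leg₁Shift N s = leg₁Shift (fun t => M t * N t) s := by
  ext ⟨i, a⟩ ⟨j, b⟩
  fin_cases a <;> fin_cases b <;>
    simp [leg₁Shift, Matrix.mul_apply, Fintype.sum_prod_type, Fin.sum_univ_two]

theorem leg₁Shift_eq_one {M : ℂ → Matrix (Fin 2) (Fin 2) A} {s : ℂ}
    (h : ∀ i, M (s + (sgn i : ℂ)) = 1) : leg₁Shift M s = 1 := by
  ext ⟨i, a⟩ ⟨j, b⟩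
  simp [leg₁Shift, h, Matrix.one_apply, Prod.mk.injEq, ← ite_and, and_comm]

theorem leg₂Shift_mul (M N : ℂ → Matrix (Fin 2) (Fin 2) A) (s : ℂ) :
    leg₂Shift M s * leg₂Shift N s = leg₂Shift (fun t => M t * N t) s := by
  ext ⟨i, a⟩ ⟨j, b⟩
  fin_cases i <;> fin_cases j <;>
    simp [leg₂Shift, Matrix.mul_apply, Fintype.sum_prod_type, Fin.sum_univ_two]

theorem leg₂Shift_eq_one {M : ℂ → Matrix (Fin 2) (Fin 2) A} {s : ℂ}
    (h : ∀ i, M (s + (sgn i : ℂ)) = 1) : leg₂Shift M s = 1 := by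
  ext ⟨i, a⟩ ⟨j, b⟩
  simp [leg₂Shift, h, Matrix.one_apply, Prod.mk.injEq, ← ite_and]

theorem leg₂Shift_mul_leg₁_mul_leg₂Shift_apply (K' K : ℂ → Matrix (Fin 2) (Fin 2) A)
    (M : Matrix (Fin 2) (Fin 2) A) (s : ℂ) (i a b : Fin 2) :
    (leg₂Shift K' s * leg₁ M * leg₂Shift K s) (i, a) (i, b)
      = ∑ c, K' (s + (sgn i : ℂ)) a c * M i i * K (s + (sgn i : ℂ)) c b := by
  fin_cases i <;>
    simp [leg₂Shift, leg₁, Matrix.mul_apply, Fintype.sum_prod_type, Fin.sum_univ_two]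

theorem mul_leg₁Shift_mul_apply (Q Q' : Matrix (Fin 2 × Fin 2) (Fin 2 × Fin 2) A)
    (M : ℂ → Matrix (Fin 2) (Fin 2) A) (s : ℂ) (x y : Fin 2 × Fin 2) :
    (Q * leg₁Shift M s * Q') x y
      = ∑ e, ∑ j, ∑ k, Q x (j, e) * M (s + (sgn e : ℂ)) j k * Q' (k, e) y := by
  simp only [leg₁Shift, Matrix.mul_apply, Matrix.of_apply, Fintype.sum_prod_type,
    Fin.sum_univ_two, mul_ite, mul_zero, if_true, zero_ne_one, one_ne_zero, if_false, zero_mul,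
    add_mul]
  abel

end Legs

/-- The exchange with `X` determines `Q₁`. Inserting this in front of `X₁' * Y₁` and applying the
exchange with `Y` brings `S'` next to `S`, where they cancel because both exchanges share the same
`S`. -/
theorem mul_mul_eq_of_exchange {R : Type*} [Monoid R]
    {K X Y X' K₁ X₁ Y₁ X₁' K₁' S S' Q₁ Q Q' : R}
    (hX : K * X₁ = S * X * K₁ * Q₁) (hY : K * Y₁ = S * Y * K₁ * Q)
    (hS : S' * S = 1) (hX' : X' * X = 1) (hK₁ : K₁' * K₁ = 1) (hX₁ : X₁ * X₁' = 1)
    (hQ : Q * Q' = 1) :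
    Q₁ * (X₁' * Y₁) * Q' = K₁' * (X' * Y) * K₁ := by
  have h : K₁' * X' * S' * K * X₁ = Q₁ := by
    calc K₁' * X' * S' * K * X₁ = K₁' * X' * S' * (K * X₁) := by simp only [mul_assoc]
      _ = K₁' * (X' * (S' * S) * X) * K₁ * Q₁ := by rw [hX]; simp only [mul_assoc]
      _ = Q₁ := by rw [hS, mul_one, hX', mul_one, hK₁, one_mul]
  calc Q₁ * (X₁' * Y₁) * Q' = K₁' * X' * S' * K * (X₁ * X₁') * Y₁ * Q' := by
        rw [← h]; simp only [mul_assoc]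
    _ = K₁' * X' * S' * (K * Y₁) * Q' := by rw [hX₁, mul_one]; simp only [mul_assoc]
    _ = K₁' * X' * (S' * S) * Y * K₁ * (Q * Q') := by rw [hY]; simp only [mul_assoc]
    _ = K₁' * (X' * Y) * K₁ := by rw [hS, hQ, mul_one, mul_one]; simp only [mul_assoc]

/-- If conjugation by `K(λ)` shifts `T(λ)`, then `T` intertwines with the entries of `K`. -/
theorem commute_of_conj {A : Type*} [Ring A] {K K' : Matrix (Fin 2) (Fin 2) A} {t : A} {t' : Fin 2 → A}
    (hK : K * K' = 1) (h : ∀ a b, ∑ c, K' a c * t * K c b = if a = b then t' a else 0)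
    (a b : Fin 2) :
    t * K a b = K a b * t' b ∧ t' a * K' a b = K' a b * t := by
  have hm : K' * Matrix.scalar (Fin 2) t * K = Matrix.diagonal t' := by
    ext a b
    rw [Matrix.mul_apply]
    simp only [Matrix.scalar_apply, Matrix.mul_diagonal, h, Matrix.diagonal_apply]
  have h₁ : Matrix.scalar (Fin 2) t * K = K * Matrix.diagonal t' := by
    rw [← hm, ← mul_assoc, ← mul_assoc, hK, one_mul]
  have h₂ : Matrix.diagonal t' * K' = K' * Matrix.scalar (Fin 2) t := by
    rw [← hm, mul_assoc, hK, mul_one]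
  constructor
  · simpa using congrFun (congrFun h₁ a) b
  · simpa using congrFun (congrFun h₂ a) b

section Invariance

variable {A : Type*} [Ring A] [Algebra ℂ A]

/-- The conjugation relation is taken at `λ - σ_i`, in its entry from `(i, b)` to `(i, a)`: the
shift of `K` by the weight `σ_i` restores the argument `λ`, so summing against `N_i` produces the
conjugated trace. On the other side the crossing relation carries out the sum over `i` and `e`. -/
theorem sum_mul_dynTrace_mul {q p s : ℂ} {M K K' : ℂ → Matrix (Fin 2) (Fin 2) A}
    {Q Q' : ℂ → Matrix (Fin 2 × Fin 2) (Fin 2 × Fin 2) ℂ}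
    (hconj : ∀ i, (Q (s - (sgn i : ℂ))).map (algebraMap ℂ A) * leg₁Shift M (s - (sgn i : ℂ))
        * (Q' (s - (sgn i : ℂ))).map (algebraMap ℂ A)
      = leg₂Shift K' (s - (sgn i : ℂ)) * leg₁ (M (s - (sgn i : ℂ)))
        * leg₂Shift K (s - (sgn i : ℂ)))
    (hQ : ∀ t x y, sgn x.1 + sgn x.2 ≠ sgn y.1 + sgn y.2 → Q t x y = 0)
    (hcross : Crossing q p s Q Q') (a b : Fin 2) :
    ∑ c, K' s a c * dynTrace q p M s * K s c b
      = if a = b then dynTrace q p M (s + (sgn a : ℂ)) else 0 := by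
  have h₁ : ∑ c, K' s a c * dynTrace q p M s * K s c b
      = ∑ i, NDiag q p s i • (leg₂Shift K' (s - (sgn i : ℂ)) * leg₁ (M (s - (sgn i : ℂ)))
        * leg₂Shift K (s - (sgn i : ℂ))) (i, a) (i, b) := by
    simp only [leg₂Shift_mul_leg₁_mul_leg₂Shift_apply, sub_add_cancel, dynTrace,
      Finset.smul_sum, Finset.mul_sum, Finset.sum_mul, mul_smul_comm, smul_mul_assoc]
    exact Finset.sum_comm
  have h₂ : ∀ i e j k : Fin 2, NDiag q p s i • ((Q (s - (sgn i : ℂ))).map (algebraMap ℂ A) (i, a)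
        (j, e) * M (s - (sgn i : ℂ) + (sgn e : ℂ)) j k
        * (Q' (s - (sgn i : ℂ))).map (algebraMap ℂ A) (k, e) (i, b))
      = (NDiag q p s i * (Q (s - (sgn i : ℂ)) (i, a) (j, e)
          * Q' (s - (sgn i : ℂ)) (k, e) (i, b))) • M (s + (sgn a : ℂ) - (sgn j : ℂ)) j k := by
    intro i e j k
    by_cases h : sgn i + sgn a = sgn j + sgn e
    -- Weight conservation makes the argument of `M` independent of `i` and `e`, so that `M` can be
    -- pulled out of the crossing sum.
    · have e₁ : s - (sgn i : ℂ) + (sgn e : ℂ) = s + (sgn a : ℂ) - (sgn j : ℂ) := by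
        have := congrArg (Int.cast : ℤ → ℂ) h
        push_cast at this
        linear_combination -this
      rw [e₁, Matrix.map_apply, Matrix.map_apply, ← Algebra.smul_def, ← Algebra.commutes,
        ← Algebra.smul_def, smul_smul, smul_smul, mul_assoc,
        mul_comm (Q' (s - (sgn i : ℂ)) (k, e) (i, b))]
    · simp [hQ _ (i, a) (j, e) h]
  rw [h₁]
  simp only [← hconj, mul_leg₁Shift_mul_apply, Finset.smul_sum, h₂]
  have h₃ : ∀ j k : Fin 2, (∑ i, ∑ e, (NDiag q p s i * (Q (s - (sgn i : ℂ)) (i, a) (j, e)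
          * Q' (s - (sgn i : ℂ)) (k, e) (i, b))) • M (s + (sgn a : ℂ) - (sgn j : ℂ)) j k)
      = (if j = k ∧ a = b then NDiag q p (s + (sgn a : ℂ)) j else 0)
        • M (s + (sgn a : ℂ) - (sgn j : ℂ)) j k := by
    intro j k
    rw [← hcross a b j k]
    simp only [Finset.sum_smul]
  have h₄ : ∀ f : Fin 2 → Fin 2 → Fin 2 → Fin 2 → A,
      ∑ i, ∑ e, ∑ j, ∑ k, f i e j k = ∑ j, ∑ k, ∑ i, ∑ e, f i e j k := by
    intro f
    simp only [Fin.sum_univ_two]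
    abel
  rw [h₄]
  simp only [h₃, dynTrace]
  by_cases hab : a = b
  · simp [hab]
  · simp [hab]

/-- A diagonal entry begins and ends at the same index `i`, so the shift of `T` caused by `X'` is
undone by `Y`; the weights `N_i` are scalars. -/
theorem commute_dynTrace {q p s : ℂ} {T : ℂ → A} {X' Y : ℂ → Matrix (Fin 2) (Fin 2) A}
    (hX : ∀ i a b, T (s - (sgn i : ℂ) + (sgn a : ℂ)) * X' (s - (sgn i : ℂ)) a b
      = X' (s - (sgn i : ℂ)) a b * T (s - (sgn i : ℂ)))
    (hY : ∀ i a b, T (s - (sgn i : ℂ)) * Y (s - (sgn i : ℂ)) a b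
      = Y (s - (sgn i : ℂ)) a b * T (s - (sgn i : ℂ) + (sgn b : ℂ))) :
    Commute (T s) (dynTrace q p (fun u => X' u * Y u) s) := by
  refine Commute.sum_right _ _ _ fun i _ => Commute.smul_right ?_ _
  simp only [Matrix.mul_apply]
  refine Commute.sum_right _ _ _ fun j _ => ?_
  have h₁ := hX i i j
  have h₂ := hY i j i
  rw [sub_add_cancel] at h₁ h₂
  rw [Commute, SemiconjBy, ← mul_assoc, h₁, mul_assoc, h₂, mul_assoc]

/-- `P` singles out the parameters at which the relations hold. It must be stable under shifts,
since the relations are used at `λ - σ_i` and the inverses at the neighbours of that point. -/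
theorem dynTrace_intertwine {q p s : ℂ} {X X' Y K K' : ℂ → Matrix (Fin 2) (Fin 2) A}
    {Q₁ Q Q' : ℂ → Matrix (Fin 2 × Fin 2) (Fin 2 × Fin 2) ℂ}
    {S S' : ℂ → Matrix (Fin 2 × Fin 2) (Fin 2 × Fin 2) A} {P : ℂ → Prop}
    (hP : ∀ t, P t → ∀ i, P (t + (sgn i : ℂ)) ∧ P (t - (sgn i : ℂ)))
    (hX : ∀ t, P t → leg₂ (K t) * leg₁Shift X t
      = S t * leg₁ (X t) * leg₂Shift K t * (Q₁ t).map (algebraMap ℂ A))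
    (hY : ∀ t, P t → leg₂ (K t) * leg₁Shift Y t
      = S t * leg₁ (Y t) * leg₂Shift K t * (Q t).map (algebraMap ℂ A))
    (hS : ∀ t, P t → S' t * S t = 1) (hXX' : ∀ t, P t → X t * X' t = 1)
    (hX'X : ∀ t, P t → X' t * X t = 1) (hKK' : ∀ t, P t → K t * K' t = 1)
    (hK'K : ∀ t, P t → K' t * K t = 1) (hQQ' : ∀ t, P t → Q t * Q' t = 1)
    (hQ₁ : ∀ t x y, sgn x.1 + sgn x.2 ≠ sgn y.1 + sgn y.2 → Q₁ t x y = 0)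
    (hcross : Crossing q p s Q₁ Q') (hs : P s) (a b : Fin 2) :
    let T := dynTrace q p fun t => X' t * Y t
    T s * K s a b = K s a b * T (s + (sgn b : ℂ)) ∧
      T (s + (sgn a : ℂ)) * K' s a b = K' s a b * T s := by
  refine commute_of_conj (t' := fun i => dynTrace q p (fun t => X' t * Y t) (s + (sgn i : ℂ)))
    (hKK' s hs) (sum_mul_dynTrace_mul (fun i => ?_) hQ₁ hcross) a b
  have ht := (hP s hs i).2
  generalize s - (sgn i : ℂ) = t at ht
  rw [← leg₁Shift_mul, ← leg₁_mul]
  refine mul_mul_eq_of_exchange (hX t ht) (hY t ht) (hS t ht) ?_ ?_ ?_ ?_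
  · rw [leg₁_mul, hX'X t ht, leg₁_one]
  · rw [leg₂Shift_mul]
    exact leg₂Shift_eq_one fun i => hK'K _ (hP t ht i).1
  · rw [leg₁Shift_mul]
    exact leg₁Shift_eq_one fun i => hXX' _ (hP t ht i).1
  · rw [← Matrix.map_mul, hQQ' t ht, Matrix.map_one _ (map_zero _) (map_one _)]

end Invariance

/-! ### The relations in the quotient algebra -/

section Swap

variable {A : Type*} [Ring A]

theorem leg₁_swap (M : Matrix (Fin 2) (Fin 2) A) :
    (leg₁ M).submatrix Prod.swap Prod.swap = leg₂ M := rfl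

theorem leg₂_swap (M : Matrix (Fin 2) (Fin 2) A) :
    (leg₂ M).submatrix Prod.swap Prod.swap = leg₁ M := rfl

theorem leg₁Shift_swap (M : ℂ → Matrix (Fin 2) (Fin 2) A) (s : ℂ) :
    (leg₁Shift M s).submatrix Prod.swap Prod.swap = leg₂Shift M s := rfl

theorem leg₂Shift_swap (M : ℂ → Matrix (Fin 2) (Fin 2) A) (s : ℂ) :
    (leg₂Shift M s).submatrix Prod.swap Prod.swap = leg₁Shift M s := rfl

theorem submatrix_swap_mul (M N : Matrix (Fin 2 × Fin 2) (Fin 2 × Fin 2) A) :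
    (M * N).submatrix Prod.swap Prod.swap
      = M.submatrix Prod.swap Prod.swap * N.submatrix Prod.swap Prod.swap :=
  (Matrix.submatrix_mul_equiv M N Prod.swap (Equiv.prodComm (Fin 2) (Fin 2)) Prod.swap).symm

theorem submatrix_swap_mul_eq_one {M N : Matrix (Fin 2 × Fin 2) (Fin 2 × Fin 2) A}
    (h : M * N = 1) :
    M.submatrix Prod.swap Prod.swap * N.submatrix Prod.swap Prod.swap = 1 := by
  rw [← submatrix_swap_mul, h]
  exact Matrix.submatrix_one_equiv (Equiv.prodComm (Fin 2) (Fin 2))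

end Swap

theorem Admissible.shift {q p κ s : ℂ} (hq₀ : q ≠ 0) (hp₀ : p ≠ 0) (hs : Admissible q p κ s)
    (n : ℤ) : Admissible q p κ (s + n) := by
  refine ⟨fun h => hs.1 ?_, fun h => hs.2 ?_⟩
  · rw [dynW_add_intCast hq₀] at h
    exact (mul_mem_lattice_iff hq₀ hp₀ (zpow_mem_lattice n)).1 h
  · rw [add_right_comm, dynW_add_intCast hq₀] at h
    exact (mul_mem_lattice_iff hq₀ hp₀ (zpow_mem_lattice n)).1 h

theorem Admissible.sgn {q p κ s : ℂ} (hq₀ : q ≠ 0) (hp₀ : p ≠ 0) (hs : Admissible q p κ s)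
    (i : Fin 2) :
    Admissible q p κ (s + (sgn i : ℂ)) ∧ Admissible q p κ (s - (DynamicalElliptic.sgn i : ℂ)) := by
  refine ⟨hs.shift hq₀ hp₀ _, ?_⟩
  have h := hs.shift hq₀ hp₀ (-(DynamicalElliptic.sgn i))
  rwa [Int.cast_neg, ← sub_eq_add_neg] at h

variable (q p κ : ℂ) (c : ℤ)

/-- The functions of `h` in the algebra. -/
def cartanHom : (ℤ → ℂ) →+* BAlg q p κ c where
  toFun f := RingQuot.mkAlgHom ℂ (Rel q p κ c) (freeCartan f)
  map_one' := by
    have h := RingQuot.mkAlgHom_rel ℂ (Rel.cartan_const (q := q) (p := p) (κ := κ) (c := c) 1)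
    rw [map_one, map_one] at h
    exact h
  map_zero' := by
    have h := RingQuot.mkAlgHom_rel ℂ (Rel.cartan_const (q := q) (p := p) (κ := κ) (c := c) 0)
    rw [map_zero, map_zero] at h
    exact h
  map_add' f g := by rw [← map_add]; exact RingQuot.mkAlgHom_rel ℂ (Rel.cartan_add f g)
  map_mul' f g := by rw [← map_mul]; exact RingQuot.mkAlgHom_rel ℂ (Rel.cartan_mul f g)

/-- `R*(z, λ + h)`. -/
def starR (z s : ℂ) : Matrix (Fin 2 × Fin 2) (Fin 2 × Fin 2) (BAlg q p κ c) :=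
  (Matrix.of fun a b (m : ℤ) => RMat q (starNome q p c) z (s + κ + (m : ℂ)) a b).map
    (cartanHom q p κ c)

/-- The inverse of `R*(z, λ + h)`. -/
def starRInv (z s : ℂ) : Matrix (Fin 2 × Fin 2) (Fin 2 × Fin 2) (BAlg q p κ c) :=
  (Matrix.of fun a b (m : ℤ) => RInv q (starNome q p c) z (s + κ + (m : ℂ)) a b).map
    (cartanHom q p κ c)

variable {q p κ c}

theorem of_mul_of_eq_one {M N : ℤ → Matrix (Fin 2 × Fin 2) (Fin 2 × Fin 2) ℂ}
    (h : ∀ m, M m * N m = 1) :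
    (Matrix.of fun a b m => M m a b) * (Matrix.of fun a b m => N m a b)
      = (1 : Matrix (Fin 2 × Fin 2) (Fin 2 × Fin 2) (ℤ → ℂ)) := by
  ext a b m
  have := congrFun (congrFun (h m) a) b
  rw [Matrix.mul_apply] at this ⊢
  rw [Finset.sum_apply]
  simp only [Matrix.of_apply, Pi.mul_apply, this, Matrix.one_apply]
  split_ifs <;> rfl

/-- The entries are functions of `h`, so inversion takes place separately at each eigenvalue `κ +
m`. Admissibility keeps all these shifted parameters off the singular lattice. -/
theorem starR_inverse (hq₀ : q ≠ 0) (hq : ‖q‖ < 1) (hp₀ : p ≠ 0) (hp : ‖starNome q p c‖ < 1)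
    {z s : ℂ} (hz₀ : z ≠ 0) (hz : z ∉ lattice q p) (hs : Admissible q p κ s) :
    starR q p κ c z s * starRInv q p κ c z s = 1 ∧
      starRInv q p κ c z s * starR q p κ c z s = 1 := by
  have hp₀' : starNome q p c ≠ 0 := mul_ne_zero hp₀ (zpow_ne_zero _ hq₀)
  rw [← lattice_starNome hq₀ c] at hz
  have hm : ∀ m : ℤ, dynW q (s + κ + (m : ℂ)) ∉ lattice q (starNome q p c) := by
    intro m h
    rw [lattice_starNome hq₀ c, add_right_comm] at h
    exact (hs.shift hq₀ hp₀ m).2 h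
  constructor
  · rw [starR, starRInv, ← Matrix.map_mul,
      of_mul_of_eq_one fun m => RMat_mul_RInv hq₀ hq hp₀' hp hz₀ hz (hm m),
      Matrix.map_one _ (map_zero _) (map_one _)]
  · rw [starR, starRInv, ← Matrix.map_mul,
      of_mul_of_eq_one fun m => RInv_mul_RMat hq₀ hq hp₀' hp hz₀ hz (hm m),
      Matrix.map_one _ (map_zero _) (map_one _)]

theorem lax_mul_laxInv {e : LaxSign} {z s : ℂ} (hz : z ≠ 0) (hs : Admissible q p κ s) :
    lax q p κ c e z s * laxInv q p κ c e z s = 1 := by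
  rw [lax, laxInv, ← Matrix.map_mul]
  ext i j
  rw [Matrix.map_apply, RingQuot.mkAlgHom_rel ℂ (Rel.mul_inv e z s hz hs i j), Matrix.one_apply,
    Matrix.one_apply]
  split_ifs <;> simp

theorem laxInv_mul_lax {e : LaxSign} {z s : ℂ} (hz : z ≠ 0) (hs : Admissible q p κ s) :
    laxInv q p κ c e z s * lax q p κ c e z s = 1 := by
  rw [lax, laxInv, ← Matrix.map_mul]
  ext i j
  rw [Matrix.map_apply, RingQuot.mkAlgHom_rel ℂ (Rel.inv_mul e z s hz hs i j), Matrix.one_apply,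
    Matrix.one_apply]
  split_ifs <;> simp

theorem map_leg₁ (e : LaxSign) (z s : ℂ) :
    (leg₁ (freeLax e z s)).map (RingQuot.mkAlgHom ℂ (Rel q p κ c))
      = leg₁ (lax q p κ c e z s) := by
  ext a b
  simp only [leg₁, lax, Matrix.map_apply, Matrix.of_apply]
  split_ifs <;> simp

theorem map_leg₂ (e : LaxSign) (z s : ℂ) :
    (leg₂ (freeLax e z s)).map (RingQuot.mkAlgHom ℂ (Rel q p κ c))
      = leg₂ (lax q p κ c e z s) := by
  ext a b
  simp only [leg₂, lax, Matrix.map_apply, Matrix.of_apply]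
  split_ifs <;> simp

theorem map_leg₁Shift (e : LaxSign) (z s : ℂ) :
    (leg₁Shift (freeLax e z) s).map (RingQuot.mkAlgHom ℂ (Rel q p κ c))
      = leg₁Shift (lax q p κ c e z) s := by
  ext a b
  simp only [leg₁Shift, lax, Matrix.map_apply, Matrix.of_apply]
  split_ifs <;> simp

theorem map_leg₂Shift (e : LaxSign) (z s : ℂ) :
    (leg₂Shift (freeLax e z) s).map (RingQuot.mkAlgHom ℂ (Rel q p κ c))
      = leg₂Shift (lax q p κ c e z) s := by
  ext a b
  simp only [leg₂Shift, lax, Matrix.map_apply, Matrix.of_apply]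
  split_ifs <;> simp

theorem map_freeR (z s : ℂ) : (freeR q p z s).map (RingQuot.mkAlgHom ℂ (Rel q p κ c))
    = (RMat q p z s).map (algebraMap ℂ (BAlg q p κ c)) := by
  ext a b
  simp only [freeR, Matrix.map_apply, AlgHom.commutes]

theorem map_freeRCartan (z s : ℂ) :
    (freeRCartan q (starNome q p c) κ z s).map (RingQuot.mkAlgHom ℂ (Rel q p κ c))
      = starR q p κ c z s := rfl

/-- The relation `R* L₁ L₂ = L₂ L₁ R` between Lax matrices `L^e(z₁)` and `L^f(z₂)`, with spectral
arguments `x` of `R*` and `y` of `R`. -/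
def RLL (q p κ : ℂ) (c : ℤ) (e f : LaxSign) (z₁ z₂ x y : ℂ) : Prop :=
  ∀ s, Admissible q p κ s →
    starR q p κ c x s * leg₁ (lax q p κ c e z₁ s) * leg₂Shift (lax q p κ c f z₂) s
      = leg₂ (lax q p κ c f z₂ s) * leg₁Shift (lax q p κ c e z₁) s
        * (RMat q p y s).map (algebraMap ℂ (BAlg q p κ c))

theorem rll_same (e : LaxSign) {z₁ z₂ : ℂ} (hz₁ : z₁ ≠ 0) (hz₂ : z₂ ≠ 0)
    (hz : z₁ / z₂ ∉ lattice q p) : RLL q p κ c e e z₁ z₂ (z₁ / z₂) (z₁ / z₂) := by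
  intro s hs
  simp only [← map_freeR, ← map_freeRCartan, ← map_leg₁, ← map_leg₂, ← map_leg₁Shift,
    ← map_leg₂Shift, ← Matrix.map_mul]
  ext a b
  exact RingQuot.mkAlgHom_rel ℂ (Rel.rll e z₁ z₂ s hz₁ hz₂ hs hz a b)

theorem rll_mixed {z₁ z₂ : ℂ} (hz₁ : z₁ ≠ 0) (hz₂ : z₂ ≠ 0)
    (hz : q ^ c * z₁ / z₂ ∉ lattice q p) (hz' : q ^ (-c) * z₁ / z₂ ∉ lattice q p) :
    RLL q p κ c .plus .minus z₁ z₂ (q ^ c * z₁ / z₂) (q ^ (-c) * z₁ / z₂) := by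
  intro s hs
  simp only [← map_freeR, ← map_freeRCartan, ← map_leg₁, ← map_leg₂, ← map_leg₁Shift,
    ← map_leg₂Shift, ← Matrix.map_mul]
  ext a b
  exact RingQuot.mkAlgHom_rel ℂ (Rel.rll_mixed z₁ z₂ s hz₁ hz₂ hs hz hz' a b)

theorem map_algebraMap_mul_eq_one {M N : Matrix (Fin 2 × Fin 2) (Fin 2 × Fin 2) ℂ}
    {A : Type*} [Ring A] [Algebra ℂ A] (h : M * N = 1) :
    M.map (algebraMap ℂ A) * N.map (algebraMap ℂ A) = 1 := by
  rw [← Matrix.map_mul, h, Matrix.map_one _ (map_zero _) (map_one _)]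

/-- `T` intertwines with the entries of `L^f(z')` and of its inverse. -/
def Intertwines (q p κ : ℂ) (c : ℤ) (T : ℂ → BAlg q p κ c) (f : LaxSign) (z : ℂ) : Prop :=
  ∀ s, Admissible q p κ s → ∀ a b,
    T s * lax q p κ c f z s a b = lax q p κ c f z s a b * T (s + (sgn b : ℂ)) ∧
      T (s + (sgn a : ℂ)) * laxInv q p κ c f z s a b = laxInv q p κ c f z s a b * T s

/-- The trace of `L^e(z₁)⁻¹ L^{e'}(z₂)` intertwines with a Lax matrix in the second leg. -/
theorem intertwines_of_rll_left (hq₀ : q ≠ 0) (hq : ‖q‖ < 1) (hp₀ : p ≠ 0) (hp : ‖p‖ < 1)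
    (hp' : ‖starNome q p c‖ < 1) {e e' f : LaxSign} {z₁ z₂ z x y : ℂ} (hz₁ : z₁ ≠ 0)
    (hz : z ≠ 0) (hx₀ : x ≠ 0) (hx : x ∉ lattice q p) (hy₀ : y ≠ 0)
    (hy : y ∉ lattice q p) (h₁ : RLL q p κ c e f z₁ z x (q ^ 4 * y))
    (h₂ : RLL q p κ c e' f z₂ z x y) :
    Intertwines q p κ c
      (dynTrace q p fun t => laxInv q p κ c e z₁ t * lax q p κ c e' z₂ t) f z := by
  intro s hs a b
  have hy' : q ^ 4 * y ∉ lattice q p :=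
    fun h => hy ((mul_mem_lattice_iff hq₀ hp₀ pow_four_mem_lattice).1 h)
  have hy₀' : q ^ 4 * y ≠ 0 := mul_ne_zero (pow_ne_zero 4 hq₀) hy₀
  -- Solving the relation for `L₂ L₁` leaves `R⁻¹` on the right, so `Q₁` and `Q` are inverses of `R`
  -- and `Q'` is `R` itself.
  refine dynTrace_intertwine (P := Admissible q p κ) (X := lax q p κ c e z₁)
    (S := starR q p κ c x) (S' := starRInv q p κ c x) (Q₁ := RInv q p (q ^ 4 * y))
    (Q := RInv q p y) (Q' := RMat q p y)
    (fun t ht i => ht.sgn hq₀ hp₀ i) (fun t ht => ?_) (fun t ht => ?_)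
    (fun t ht => (starR_inverse hq₀ hq hp₀ hp' hx₀ hx ht).2) (fun t ht => lax_mul_laxInv hz₁ ht)
    (fun t ht => laxInv_mul_lax hz₁ ht) (fun t ht => lax_mul_laxInv hz ht)
    (fun t ht => laxInv_mul_lax hz ht)
    (fun t ht => RInv_mul_RMat hq₀ hq hp₀ hp hy₀ hy ht.1)
    (fun t x y h => sixVertex_eq_zero _ _ _ _ _ h) (crossing hq₀ hq hp₀ hp hs.1 hy₀ hy) hs a b
  · rw [h₁ t ht, mul_assoc, map_algebraMap_mul_eq_one
      (RMat_mul_RInv hq₀ hq hp₀ hp hy₀' hy' ht.1), mul_one]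
  · rw [h₂ t ht, mul_assoc, map_algebraMap_mul_eq_one
      (RMat_mul_RInv hq₀ hq hp₀ hp hy₀ hy ht.1), mul_one]

/-- The trace of `L^e(z₁)⁻¹ L^{e'}(z₂)` intertwines with a Lax matrix in the first leg. -/
theorem intertwines_of_rll_right (hq₀ : q ≠ 0) (hq : ‖q‖ < 1) (hp₀ : p ≠ 0) (hp : ‖p‖ < 1)
    (hp' : ‖starNome q p c‖ < 1) {e e' f : LaxSign} {z₁ z₂ z x y : ℂ} (hz₁ : z₁ ≠ 0)
    (hz : z ≠ 0) (hx₀ : x ≠ 0) (hx : x ∉ lattice q p) (hy₀ : y ≠ 0)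
    (hy : y ∉ lattice q p) (h₁ : RLL q p κ c f e z z₁ x y)
    (h₂ : RLL q p κ c f e' z z₂ x (q ^ 4 * y)) :
    Intertwines q p κ c
      (dynTrace q p fun t => laxInv q p κ c e z₁ t * lax q p κ c e' z₂ t) f z := by
  intro s hs a b
  have hy' : q ^ 4 * y ∉ lattice q p :=
    fun h => hy ((mul_mem_lattice_iff hq₀ hp₀ pow_four_mem_lattice).1 h)
  have hy₀' : q ^ 4 * y ≠ 0 := mul_ne_zero (pow_ne_zero 4 hq₀) hy₀
  -- Here `K` sits in the first leg. Moving `R*` to the other side and flipping the legs brings the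
  -- relation to the required shape, with `R*⁻¹` on the left and `R` itself on the right.
  have key : ∀ {g : LaxSign} {z₃ v : ℂ}, RLL q p κ c f g z z₃ x v → ∀ t, Admissible q p κ t →
      leg₂ (lax q p κ c f z t) * leg₁Shift (lax q p κ c g z₃) t
        = (starRInv q p κ c x t).submatrix Prod.swap Prod.swap * leg₁ (lax q p κ c g z₃ t)
          * leg₂Shift (lax q p κ c f z) t
          * ((RMat q p v t).submatrix Prod.swap Prod.swap).map
            (algebraMap ℂ (BAlg q p κ c)) := by
    intro g z₃ v h t ht
    have h' := congrArg (fun M => M.submatrix Prod.swap Prod.swap) (h t ht)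
    simp only [submatrix_swap_mul, leg₁_swap, leg₂_swap, leg₁Shift_swap, leg₂Shift_swap] at h'
    have hi := submatrix_swap_mul_eq_one (starR_inverse hq₀ hq hp₀ hp' hx₀ hx ht).2
    rw [← Matrix.submatrix_map, mul_assoc, mul_assoc, ← mul_assoc (leg₁ _), ← h', mul_assoc,
      ← mul_assoc, hi, one_mul]
  refine dynTrace_intertwine (P := Admissible q p κ) (X := lax q p κ c e z₁)
    (S := fun t => (starRInv q p κ c x t).submatrix Prod.swap Prod.swap)
    (S' := fun t => (starR q p κ c x t).submatrix Prod.swap Prod.swap)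
    (Q₁ := fun t => (RMat q p y t).submatrix Prod.swap Prod.swap)
    (Q := fun t => (RMat q p (q ^ 4 * y) t).submatrix Prod.swap Prod.swap)
    (Q' := fun t => (RInv q p (q ^ 4 * y) t).submatrix Prod.swap Prod.swap)
    (fun t ht i => ht.sgn hq₀ hp₀ i) (key h₁) (key h₂)
    (fun t ht => submatrix_swap_mul_eq_one (starR_inverse hq₀ hq hp₀ hp' hx₀ hx ht).1)
    (fun t ht => lax_mul_laxInv hz₁ ht)
    (fun t ht => laxInv_mul_lax hz₁ ht) (fun t ht => lax_mul_laxInv hz ht)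
    (fun t ht => laxInv_mul_lax hz ht)
    (fun t ht => submatrix_swap_mul_eq_one (RMat_mul_RInv hq₀ hq hp₀ hp hy₀' hy' ht.1))
    (fun t x y h => ?_) (crossing_swap hq₀ hq hp₀ hp hs.1 hy₀ hy) hs a b
  simp only [RMat_eq_sixVertex, sixVertex_swap]
  exact sixVertex_eq_zero _ _ _ _ _ h

/-- Two dynamical traces commute if one intertwines with the Lax matrices of the other. -/
theorem commute_of_intertwines (hq₀ : q ≠ 0) (hp₀ : p ≠ 0) {T : ℂ → BAlg q p κ c}
    {e e' : LaxSign} {z₁ z₂ s : ℂ} (hs : Admissible q p κ s)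
    (h₁ : Intertwines q p κ c T e z₁) (h₂ : Intertwines q p κ c T e' z₂) :
    Commute (T s) (dynTrace q p (fun t => laxInv q p κ c e z₁ t * lax q p κ c e' z₂ t) s) :=
  commute_dynTrace (fun i a b => (h₁ _ (hs.sgn hq₀ hp₀ i).2 a b).2)
    (fun i a b => (h₂ _ (hs.sgn hq₀ hp₀ i).2 a b).1)

/-! ### Commutativity at the critical charges `c = -2` and `c = 2` -/

theorem notMem_lattice_of_eq (hq₀ : q ≠ 0) (hp₀ : p ≠ 0) {x y : ℂ} (hx : x ∉ lattice q p) (n : ℤ)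
    (h : y = q ^ (2 * n) * x) : y ∉ lattice q p := by
  rw [h]
  exact fun h => hx ((mul_mem_lattice_iff hq₀ hp₀ (zpow_mem_lattice n)).1 h)

theorem div_notMem_lattice_symm {x y : ℂ} (h : x / y ∉ lattice q p) : y / x ∉ lattice q p :=
  fun h' => h (by rw [← inv_div]; exact lattice_inv h')

/-- With `y = q^(-2) z / z₁`, exchanging `L⁺(z)` with `L⁺(q² z₁)` involves `R*(y)` and `R(y)`, while
exchanging it with `L⁻(z₁)` involves `R*(y)` and `R(q^4 y)`. The value `c = -2` makes the arguments
of `R*` agree and those of `R` differ by the crossing shift. -/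
theorem intertwines_tGen_plus (hq₀ : q ≠ 0) (hq : ‖q‖ < 1) (hp₀ : p ≠ 0) (hp : ‖p‖ < 1)
    (hp' : ‖starNome q p (-2)‖ < 1) {z₁ z : ℂ} (hz₁ : z₁ ≠ 0) (hz : z ≠ 0)
    (h : z₁ / z ∉ lattice q p) : Intertwines q p κ (-2) (tGen q p κ (-2) z₁) .plus z := by
  have hi := div_notMem_lattice_symm h
  have hw : q ^ (-(-2) : ℤ) * z₁ ≠ 0 := mul_ne_zero (zpow_ne_zero _ hq₀) hz₁
  have e₁ : z / (q ^ (-(-2) : ℤ) * z₁) = q ^ (-2 : ℤ) * z / z₁ := by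
    rw [neg_neg, zpow_neg]; field_simp
  have e₂ : q ^ (-(-2) : ℤ) * z / z₁ = q ^ 4 * (q ^ (-2 : ℤ) * z / z₁) := by
    rw [neg_neg, zpow_neg, zpow_ofNat]; field_simp
  have n₁ := notMem_lattice_of_eq (y := q ^ (-2 : ℤ) * z / z₁) hq₀ hp₀ hi (-1) (mul_div_assoc _ _ _)
  have n₂ := notMem_lattice_of_eq (y := q ^ (-(-2) : ℤ) * z / z₁) hq₀ hp₀ hi 1
    (mul_div_assoc _ _ _)
  have h₁ := rll_same (κ := κ) (c := -2) .plus hz hw (by rwa [e₁])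
  have h₂ := rll_mixed (κ := κ) (c := -2) hz hz₁ n₁ n₂
  rw [e₁] at h₁
  rw [e₂] at h₂
  have h₀ : q ^ (-2 : ℤ) * z / z₁ ≠ 0 :=
    div_ne_zero (mul_ne_zero (zpow_ne_zero _ hq₀) hz) hz₁
  exact intertwines_of_rll_right hq₀ hq hp₀ hp hp' hw hz h₀ n₁ h₀ n₁ h₁ h₂

/-- With `y = z₁ / z`, the Lax matrices `L⁺(q² z₁)` and `L⁻(z₁)` both meet `R*(y)`, with `R(q^4 y)`
and `R(y)` respectively. -/
theorem intertwines_tGen_minus (hq₀ : q ≠ 0) (hq : ‖q‖ < 1) (hp₀ : p ≠ 0) (hp : ‖p‖ < 1)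
    (hp' : ‖starNome q p (-2)‖ < 1) {z₁ z : ℂ} (hz₁ : z₁ ≠ 0) (hz : z ≠ 0)
    (h : z₁ / z ∉ lattice q p) : Intertwines q p κ (-2) (tGen q p κ (-2) z₁) .minus z := by
  have hw : q ^ (-(-2) : ℤ) * z₁ ≠ 0 := mul_ne_zero (zpow_ne_zero _ hq₀) hz₁
  have e₁ : q ^ (-2 : ℤ) * (q ^ (-(-2) : ℤ) * z₁) / z = z₁ / z := by
    rw [neg_neg, zpow_neg]; field_simp
  have e₂ : q ^ (-(-2) : ℤ) * (q ^ (-(-2) : ℤ) * z₁) / z = q ^ 4 * (z₁ / z) := by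
    rw [neg_neg, zpow_ofNat]; ring
  have n₂ := notMem_lattice_of_eq (y := q ^ 4 * (z₁ / z)) hq₀ hp₀ h 2 rfl
  have h₁ := rll_mixed (κ := κ) (c := -2) hw hz (by rwa [e₁]) (by rwa [e₂])
  have h₂ := rll_same (κ := κ) (c := -2) .minus hz₁ hz h
  rw [e₁, e₂] at h₁
  have h₀ := div_ne_zero hz₁ hz
  exact intertwines_of_rll_left hq₀ hq hp₀ hp hp' hw hz h₀ h h₀ h h₁ h₂

/-- At `c = 2` the common argument of `R*` is `z / z₁`; the arguments of `R` are `q^(-4) z / z₁` for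
`L⁻(q² z₁)` and `z / z₁` for `L⁺(z₁)`. -/
theorem intertwines_tStarGen_plus (hq₀ : q ≠ 0) (hq : ‖q‖ < 1) (hp₀ : p ≠ 0) (hp : ‖p‖ < 1)
    (hp' : ‖starNome q p 2‖ < 1) {z₁ z : ℂ} (hz₁ : z₁ ≠ 0) (hz : z ≠ 0)
    (h : z₁ / z ∉ lattice q p) : Intertwines q p κ 2 (tStarGen q p κ 2 z₁) .plus z := by
  have hi := div_notMem_lattice_symm h
  have hw : q ^ (2 : ℤ) * z₁ ≠ 0 := mul_ne_zero (zpow_ne_zero _ hq₀) hz₁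
  have e₁ : q ^ (2 : ℤ) * z / (q ^ (2 : ℤ) * z₁) = z / z₁ :=
    mul_div_mul_left _ _ (zpow_ne_zero _ hq₀)
  have e₂ : z / z₁ = q ^ 4 * (q ^ (-2 : ℤ) * z / (q ^ (2 : ℤ) * z₁)) := by
    rw [zpow_neg, zpow_ofNat]; field_simp
  have n₂ := notMem_lattice_of_eq (y := q ^ (-2 : ℤ) * z / (q ^ (2 : ℤ) * z₁)) hq₀ hp₀ hi (-2)
    (by simp only [mul_neg, zpow_neg, zpow_ofNat]; field_simp; norm_num)
  have h₁ := rll_mixed (κ := κ) (c := 2) hz hw (by rwa [e₁]) n₂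
  have h₂ := rll_same (κ := κ) (c := 2) .plus hz hz₁ hi
  rw [e₁] at h₁
  have h₂' : RLL q p κ 2 .plus .plus z z₁ (z / z₁)
      (q ^ 4 * (q ^ (-2 : ℤ) * z / (q ^ (2 : ℤ) * z₁))) := by rwa [← e₂]
  have h₀ : q ^ (-2 : ℤ) * z / (q ^ (2 : ℤ) * z₁) ≠ 0 :=
    div_ne_zero (mul_ne_zero (zpow_ne_zero _ hq₀) hz) hw
  exact intertwines_of_rll_right hq₀ hq hp₀ hp hp' hw hz (div_ne_zero hz hz₁) hi h₀ n₂ h₁ h₂'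

/-- At `c = 2` the common argument of `R*` is `q² z₁ / z`; the arguments of `R` are `q² z₁ / z` for
`L⁻(q² z₁)` and `q^(-2) z₁ / z` for `L⁺(z₁)`. -/
theorem intertwines_tStarGen_minus (hq₀ : q ≠ 0) (hq : ‖q‖ < 1) (hp₀ : p ≠ 0) (hp : ‖p‖ < 1)
    (hp' : ‖starNome q p 2‖ < 1) {z₁ z : ℂ} (hz₁ : z₁ ≠ 0) (hz : z ≠ 0)
    (h : z₁ / z ∉ lattice q p) : Intertwines q p κ 2 (tStarGen q p κ 2 z₁) .minus z := by
  have hw : q ^ (2 : ℤ) * z₁ ≠ 0 := mul_ne_zero (zpow_ne_zero _ hq₀) hz₁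
  have e₁ : q ^ (2 : ℤ) * z₁ / z = q ^ 4 * (q ^ (-2 : ℤ) * z₁ / z) := by
    rw [zpow_neg, zpow_ofNat]; field_simp
  have n₁ := notMem_lattice_of_eq (y := q ^ (2 : ℤ) * z₁ / z) hq₀ hp₀ h 1 (mul_div_assoc _ _ _)
  have n₂ := notMem_lattice_of_eq (y := q ^ (-2 : ℤ) * z₁ / z) hq₀ hp₀ h (-1)
    (mul_div_assoc _ _ _)
  have h₁ := rll_same (κ := κ) (c := 2) .minus hw hz n₁
  have h₂ := rll_mixed (κ := κ) (c := 2) hz₁ hz n₁ n₂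
  have h₁' : RLL q p κ 2 .minus .minus (q ^ (2 : ℤ) * z₁) z (q ^ (2 : ℤ) * z₁ / z)
      (q ^ 4 * (q ^ (-2 : ℤ) * z₁ / z)) := by rwa [← e₁]
  exact intertwines_of_rll_left hq₀ hq hp₀ hp hp' hw hz (div_ne_zero hw hz) n₁
    (div_ne_zero (mul_ne_zero (zpow_ne_zero _ hq₀) hz₁) hz) n₂ h₁' h₂

theorem commute_tGen (hq₀ : q ≠ 0) (hq : ‖q‖ < 1) (hp₀ : p ≠ 0) (hp : ‖p‖ < 1) {s : ℂ}
    (hs : Admissible q p κ s) {z₁ z₂ : ℂ} (hz₁ : z₁ ≠ 0) (hz₂ : z₂ ≠ 0)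
    (hz : z₁ / z₂ ∉ lattice q p) :
    Commute (tGen q p κ (-2) z₁ s) (tGen q p κ (-2) z₂ s) := by
  -- At `c = -2` the shifted nome is `p q^4`, so its bound is automatic; at `c = 2` it is `p
  -- q^(-4)`, and the bound has to be assumed.
  have hp' : ‖starNome q p (-2)‖ < 1 := by
    have e : starNome q p (-2) = p * q ^ 4 := rfl
    rw [e, norm_mul, norm_pow]
    exact mul_lt_one_of_nonneg_of_lt_one_left (norm_nonneg _) hp
      (pow_le_one₀ (norm_nonneg _) hq.le)
  have hw : q ^ (-(-2) : ℤ) * z₂ ≠ 0 := mul_ne_zero (zpow_ne_zero _ hq₀) hz₂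
  have n := notMem_lattice_of_eq (y := z₁ / (q ^ (-(-2) : ℤ) * z₂)) hq₀ hp₀ hz (-1)
    (by simp only [neg_neg, mul_neg, mul_one, zpow_neg]; field_simp)
  exact commute_of_intertwines hq₀ hp₀ hs (intertwines_tGen_plus hq₀ hq hp₀ hp hp' hz₁ hw n)
    (intertwines_tGen_minus hq₀ hq hp₀ hp hp' hz₁ hz₂ hz)

theorem commute_tStarGen (hq₀ : q ≠ 0) (hq : ‖q‖ < 1) (hp₀ : p ≠ 0) (hp : ‖p‖ < 1)
    (hp' : ‖starNome q p 2‖ < 1) {s : ℂ} (hs : Admissible q p κ s) {z₁ z₂ : ℂ} (hz₁ : z₁ ≠ 0)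
    (hz₂ : z₂ ≠ 0) (hz : z₁ / z₂ ∉ lattice q p) :
    Commute (tStarGen q p κ 2 z₁ s) (tStarGen q p κ 2 z₂ s) := by
  have hw : q ^ (2 : ℤ) * z₂ ≠ 0 := mul_ne_zero (zpow_ne_zero _ hq₀) hz₂
  have n := notMem_lattice_of_eq (y := z₁ / (q ^ (2 : ℤ) * z₂)) hq₀ hp₀ hz (-1)
    (by simp only [mul_neg, mul_one, zpow_neg]; field_simp)
  exact commute_of_intertwines hq₀ hp₀ hs (intertwines_tStarGen_minus hq₀ hq hp₀ hp hp' hz₁ hw n)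
    (intertwines_tStarGen_plus hq₀ hq hp₀ hp hp' hz₁ hz₂ hz)

theorem mul_comm_of_mem_adjoin {A : Type*} [Ring A] [Algebra ℂ A] {Z : Set ℂ} {t : ℂ → A}
    {r : ℂ → ℂ → Prop} (hZ : Z.Pairwise r)
    (h : ∀ z₁ ∈ Z, ∀ z₂ ∈ Z, r z₁ z₂ → Commute (t z₁) (t z₂)) :
    ∀ x ∈ Algebra.adjoin ℂ (t '' Z), ∀ y ∈ Algebra.adjoin ℂ (t '' Z), x * y = y * x := by
  have hc : ∀ a ∈ t '' Z, ∀ b ∈ t '' Z, a * b = b * a := by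
    rintro _ ⟨z₁, h₁, rfl⟩ _ ⟨z₂, h₂, rfl⟩
    by_cases e : z₁ = z₂
    · rw [e]
    · exact h z₁ h₁ z₂ h₂ (hZ h₁ h₂ e)
  intro x hx y hy
  exact congrArg Subtype.val
    ((Algebra.isMulCommutative_adjoin ℂ hc).is_comm.comm
      (⟨x, hx⟩ : Algebra.adjoin ℂ (t '' Z)) ⟨y, hy⟩)

end DynamicalElliptic

end

open DynamicalElliptic in
theorem mainTheorem2 (q p κ s : ℂ) (hq₀ : q ≠ 0) (hq : ‖q‖ < 1) (hp₀ : p ≠ 0) (hp : ‖p‖ < 1)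
    (hs : Admissible q p κ s) :
    ((∀ z₁ z₂ : ℂ, z₁ ≠ 0 → z₂ ≠ 0 → z₁ / z₂ ∉ lattice q p →
        ⁅tGen q p κ (-2) z₁ s, tGen q p κ (-2) z₂ s⁆ = 0) ∧
      (∀ Z : Set ℂ, 0 ∉ Z → Z.Pairwise (fun z₁ z₂ => z₁ / z₂ ∉ lattice q p) →
        ∀ x ∈ Algebra.adjoin ℂ ((fun z => tGen q p κ (-2) z s) '' Z),
          ∀ y ∈ Algebra.adjoin ℂ ((fun z => tGen q p κ (-2) z s) '' Z), x * y = y * x)) ∧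
    (‖starNome q p 2‖ < 1 →
      (∀ z₁ z₂ : ℂ, z₁ ≠ 0 → z₂ ≠ 0 → z₁ / z₂ ∉ lattice q p →
        ⁅tStarGen q p κ 2 z₁ s, tStarGen q p κ 2 z₂ s⁆ = 0) ∧
      (∀ Z : Set ℂ, 0 ∉ Z → Z.Pairwise (fun z₁ z₂ => z₁ / z₂ ∉ lattice q p) →
        ∀ x ∈ Algebra.adjoin ℂ ((fun z => tStarGen q p κ 2 z s) '' Z),
          ∀ y ∈ Algebra.adjoin ℂ ((fun z => tStarGen q p κ 2 z s) '' Z), x * y = y * x)) := by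
  have ne : ∀ {Z : Set ℂ}, 0 ∉ Z → ∀ z ∈ Z, z ≠ 0 := fun h z hz hz0 => h (hz0 ▸ hz)
  refine ⟨⟨fun z₁ z₂ h₁ h₂ hz => ?_, fun Z hZ0 hZ => ?_⟩,
    fun hp' => ⟨fun z₁ z₂ h₁ h₂ hz => ?_, fun Z hZ0 hZ => ?_⟩⟩
  · exact (commute_tGen hq₀ hq hp₀ hp hs h₁ h₂ hz).lie_eq
  · exact mul_comm_of_mem_adjoin hZ fun z₁ h₁ z₂ h₂ hz =>
      commute_tGen hq₀ hq hp₀ hp hs (ne hZ0 z₁ h₁) (ne hZ0 z₂ h₂) hz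
  · exact (commute_tStarGen hq₀ hq hp₀ hp hp' hs h₁ h₂ hz).lie_eq
  · exact mul_comm_of_mem_adjoin hZ fun z₁ h₁ z₂ h₂ hz =>
      commute_tStarGen hq₀ hq hp₀ hp hp' hs (ne hZ0 z₁ h₁) (ne hZ0 z₂ h₂) hz
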